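/- Notation. For $\mathbf x,\mathbf y\in\mathbb R^n$ put $\mathbf x\cdot\mathbf y=\sum_i x_iy_i$, $\|\mathbf x\|=\max_i|x_i|$ and $\Pi_+(\mathbf x)=\prod_{i=1}^n\max(|x_i|,1)$. A vector $\mathbf y\in\mathbb R^n$ is *very well approximable* (VWA) if for some $\varepsilon>0$ there are infinitely many $\mathbf q\in\mathbb Z^n$ such that $|\mathbf q\cdot\mathbf y+p|\,\|\mathbf q\|^n\le\|\mathbf q\|^{-n\varepsilon}$ for some $p\in\mathbb Z$; it is *very well multiplicatively approximable* (VWMA) if for some $\varepsilon>0$ there are infinitely many $\mathbf q\in\mathbb Z^n$ such that $|\mathbf q\cdot\mathbf y+p|\,\Pi_+(\mathbf q)\le\Pi_+(\mathbf q)^{-\varepsilon}$ for some $p\in\mathbb Z$. Let $U\subset\mathbb R^d$ be open and $\mathbf f=(f_1,\dots,f_n):U\to\mathbb R^n$. "Almost every point of $M=\mathbf f(U)$" has a property means that $\mathbf f(\mathbf x)$ has it for Lebesgue-almost every $\mathbf x\in U$. The set $M$ is *extremal* (respectively *strongly extremal*) if almost every point of $M$ is not VWA (respectively not VWMA). If $\mathbf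 f$ is of class $C^m$, $m\in\{0,1,2,\dots\}\cup\{\infty\}$, the point $\mathbf f(\mathbf x)$ is *nondegenerate* (at the parameter $\mathbf x$) if for some finite $l\le m$ the space $\mathbb R^n$ is spanned by the partial derivatives of $\mathbf f$ at $\mathbf x$ of orders $1,\dots,l$. **Theorem A.** Let $U\subset\mathbb R^d$ be open and let $f_1,\dots,f_n\in C^m(U)$ be such that almost every point of $M=\{\mathbf f(\mathbf x)\mid\mathbf x\in U\}$ is nondegenerate. Then $M$ is strongly extremal. Moreover, the following hold: (H2) if $U\subset\mathbb R^d$ is a domain (open and connected) and $f_1,\dots,f_n$ are real analytic functions on $U$ which together with $1$ are linearly independent over $\mathbb R$, then $M=\mathbf f(U)$ is strongly extremal; (H1) under the assumptions of (H2), $M$ is extremal; (Mahler) for every $n$ and Lebesgue-almost every $x\in\mathbb R$, the vector $(x,x^2,\dots,x^n)$ is not VWA. -/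

import Mathlib

open MeasureTheory

namespace DiophApprox

/-- `|x|₊ = max (|x|, 1)`. -/
noncomputable def absPlus (x : ℝ) : ℝ := max |x| 1

/-- `Π₊(x) = ∏ i, |x i|₊`. -/
noncomputable def prodPlus {n : ℕ} (x : Fin n → ℝ) : ℝ := ∏ i, absPlus (x i)

/-- `y ∈ ℝⁿ` is very well approximable: for some `ε > 0` there are infinitely many `q ∈ ℤⁿ` with
`|q·y + p| ‖q‖ⁿ ≤ ‖q‖^(-nε)` for some `p ∈ ℤ`. Here `‖q‖` is the maximum norm. -/
def IsVWA {n : ℕ} (y : Fin n → ℝ) : Prop :=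
  ∃ ε : ℝ, 0 < ε ∧
    {q : Fin n → ℤ | ∃ p : ℤ,
      |(∑ i, (q i : ℝ) * y i) + (p : ℝ)| * ‖q‖ ^ n ≤ ‖q‖ ^ (-((n : ℝ) * ε))}.Infinite

/-- `y ∈ ℝⁿ` is very well multiplicatively approximable: for some `ε > 0` there are infinitely many
`q ∈ ℤⁿ` with `|q·y + p| Π₊(q) ≤ Π₊(q)^(-ε)` for some `p ∈ ℤ`. -/
def IsVWMA {n : ℕ} (y : Fin n → ℝ) : Prop :=
  ∃ ε : ℝ, 0 < ε ∧
    {q : Fin n → ℤ | ∃ p : ℤ,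
      |(∑ i, (q i : ℝ) * y i) + (p : ℝ)| * prodPlus (fun i => (q i : ℝ))
        ≤ prodPlus (fun i => (q i : ℝ)) ^ (-ε)}.Infinite

/-- The parametrized set `M = f(U)` is extremal: almost every point of `M`, for the measure class
coming from Lebesgue measure on `U` through `f`, is not very well approximable. -/
def IsExtremal {d n : ℕ} (U : Set (Fin d → ℝ)) (f : (Fin d → ℝ) → (Fin n → ℝ)) : Prop :=
  ∀ᵐ x ∂(volume.restrict U), ¬ IsVWA (f x)

/-- The parametrized set `M = f(U)` is strongly extremal: almost every point of `M`, for the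
measure class coming from Lebesgue measure on `U` through `f`, is not very well multiplicatively
approximable. -/
def IsStronglyExtremal {d n : ℕ} (U : Set (Fin d → ℝ)) (f : (Fin d → ℝ) → (Fin n → ℝ)) : Prop :=
  ∀ᵐ x ∂(volume.restrict U), ¬ IsVWMA (f x)

/-- The partial derivative `∂_{i 0} ⋯ ∂_{i (k-1)} f (x)` of order `k`. -/
noncomputable def partialDeriv {d n k : ℕ} (f : (Fin d → ℝ) → (Fin n → ℝ)) (i : Fin k → Fin d)
    (x : Fin d → ℝ) : Fin n → ℝ :=
  iteratedFDeriv ℝ k f x (fun j => Pi.single (i j) 1)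

/-- `f` is `l`-nondegenerate at `x`: its partial derivatives at `x` of orders `1, …, l` span `ℝⁿ`.
The value `f x` itself is not one of the spanning vectors. -/
def IsNondegenerateOfOrder {d n : ℕ} (l : ℕ) (f : (Fin d → ℝ) → (Fin n → ℝ))
    (x : Fin d → ℝ) : Prop :=
  Submodule.span ℝ {v : Fin n → ℝ | ∃ k : ℕ, 1 ≤ k ∧ k ≤ l ∧
    ∃ i : Fin k → Fin d, v = partialDeriv f i x} = ⊤

/-- A map `f` of class `C^m` is nondegenerate at `x`: it is `l`-nondegenerate there for some
finite `l ≤ m`. -/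
def IsNondegenerate {d n : ℕ} (m : ℕ∞) (f : (Fin d → ℝ) → (Fin n → ℝ)) (x : Fin d → ℝ) : Prop :=
  ∃ l : ℕ, (l : ℕ∞) ≤ m ∧ IsNondegenerateOfOrder l f x

/-- The functions `1, f₁, …, fₙ` on `U` are linearly independent over `ℝ`. -/
def LinIndepWithOne {d n : ℕ} (U : Set (Fin d → ℝ)) (f : (Fin d → ℝ) → (Fin n → ℝ)) : Prop :=
  LinearIndependent ℝ
    (Fin.cons (fun _ => 1) (fun (i : Fin n) (x : U) => f x i) : Fin (n + 1) → U → ℝ)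

end DiophApprox

/-!
The proof follows Kleinbock and Margulis: approximation of `f x` is translated into the dynamics
of lattices, and a quantitative nondivergence estimate is combined with the Borel-Cantelli lemma.
All measure estimates are made on the cubes of one fixed dyadic grid.

*Dynamics.* Put `u_y (p, q) = (p + q · y, q)` and
`g_t = diag(2^(t₁ + ⋯ + tₙ), 2^(-t₁), …, 2^(-tₙ))` for `t ∈ ℕⁿ`. If `y` is very well
multiplicatively approximable, then for some `a < 1` and infinitely many `t` the lattice
`g_t u_y ℤ^(n+1)` contains a nonzero vector of norm `O(a^(t₁ + ⋯ + tₙ))`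
(`IsVWMA.exists_infinite_short`). By Borel-Cantelli it suffices that near a nondegenerate point
the set of `x` for which `g_t u_{f x} ℤ^(n+1)` has a nonzero vector shorter than `ε` has measure
`O(ε^α)`, uniformly in `t` (`IsNondegenerateOfOrder.exists_volume_short_le`).

*Nondivergence.* To a rational subspace `V` one attaches the function `ψ_V` of `x` that gives the
size of the image of `V ∩ ℤ^(n+1)` under `g_t u_{f x}`, here the largest minor of the image of an
integer basis. If at `x` there is a flag whose members have `ψ_V x ∈ [ε, ρ]`, with `ρ ≤ 1`, and
`ψ_V x ≥ ρ` for all other `V` comparable with the flag, then the lattice has no nonzero vector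
shorter than `ε / (n + 1)` (`le_norm_flowMap_of_isProtecting`). The set of `x` without such a flag
is estimated by induction on the length of the flag (`volume_unprotected_le`); this uses only that
each `ψ_V` is continuous and at least `ρ` somewhere on the initial cube, and that the relative
measure of `{ψ_V < ε}` is `O((ε/ρ)^α)` on each cube on which `ψ_V` reaches `ρ`. Maximal dyadic
cubes replace a covering theorem.

*Good functions.* The minors are affine combinations `c₀ + c · f`, and one of them dominates a
combination with integer coefficients, not all zero (`exists_le_minors_flowMap`). So both
requirements follow from a sublevel set estimate for the functions `c₀ + c · f` on small cubes
around a nondegenerate point (`IsNondegenerateOfOrder.exists_good`). On such a cube, of side `r`,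
the derivatives of order `l` of `c₀ + c · f` are nearly constant compared with the jet size
`T = ∑ r^i ‖Dⁱ‖`, `i ≤ l`, so `T` is comparable at all points of the cube and bounds the function.
At each point some pure directional derivative of order `j ≤ l` is of size `T / r^j`, by symmetry
of the derivatives and polarization, and it remains so on a cube of comparable side. A
one-variable estimate along lines finishes the argument (`exists_volume_sublevel_le`).

For analytic `f` on a connected set, linear independence of `1, f₁, …, fₙ` makes every point
nondegenerate (`isNondegenerate_of_linIndepWithOne`), and a very well approximable vector is very
well multiplicatively approximable (`IsVWA.isVWMA`).
-/

namespace DiophApprox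

/-! ### Dyadic cubes -/

/-- The half-open dyadic cube of side `2⁻ᴺ` of the standard grid that contains `x`. -/
def dyadicCube {d : ℕ} (N : ℕ) (x : Fin d → ℝ) : Set (Fin d → ℝ) :=
  {y | ∀ i, ⌊(2 : ℝ) ^ N * y i⌋ = ⌊(2 : ℝ) ^ N * x i⌋}

section DyadicCube

variable {d : ℕ} {N m : ℕ} {x y z : Fin d → ℝ}

lemma mem_dyadicCube_self : x ∈ dyadicCube N x := fun _ => rfl

lemma dyadicCube_eq_of_mem (h : y ∈ dyadicCube N x) : dyadicCube N y = dyadicCube N x := by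
  ext z
  exact forall_congr' fun i => by rw [h i]

lemma dyadicCube_eq_pi (N : ℕ) (x : Fin d → ℝ) :
    dyadicCube N x = Set.pi Set.univ fun i =>
      Set.Ico ((⌊(2 : ℝ) ^ N * x i⌋ : ℝ) / 2 ^ N)
        ((⌊(2 : ℝ) ^ N * x i⌋ : ℝ) / 2 ^ N + (2 ^ N)⁻¹) := by
  ext y
  have h2 : (0 : ℝ) < 2 ^ N := by positivity
  simp only [dyadicCube, Set.mem_ofPred_eq, Set.mem_pi, Set.mem_univ, true_imp_iff, Set.mem_Ico]
  refine forall_congr' fun i => ?_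
  rw [Int.floor_eq_iff, div_le_iff₀ h2, ← one_div, ← add_div, lt_div_iff₀ h2, mul_comm (y i)]

lemma measurableSet_dyadicCube : MeasurableSet (dyadicCube N x) := by
  rw [dyadicCube_eq_pi]
  exact MeasurableSet.univ_pi fun i => measurableSet_Ico

lemma convex_dyadicCube : Convex ℝ (dyadicCube N x) := by
  rw [dyadicCube_eq_pi]
  exact convex_pi fun i _ => convex_Ico _ _

lemma volume_dyadicCube : volume (dyadicCube N x) = ENNReal.ofReal ((2 ^ N)⁻¹) ^ d := by
  rw [dyadicCube_eq_pi, Real.volume_pi_Ico]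
  simp

lemma volume_dyadicCube_eq_succ :
    volume (dyadicCube N x) = 2 ^ d * volume (dyadicCube (N + 1) y) := by
  rw [volume_dyadicCube, volume_dyadicCube, ← mul_pow]
  congr 1
  rw [show (2 : ENNReal) = ENNReal.ofReal 2 by simp, ← ENNReal.ofReal_mul (by norm_num), pow_succ]
  congr 1
  field_simp

lemma volume_dyadicCube_ne_top : volume (dyadicCube N x) ≠ ⊤ := by
  rw [volume_dyadicCube]
  exact ENNReal.pow_ne_top ENNReal.ofReal_ne_top

lemma volume_dyadicCube_ne_zero : volume (dyadicCube N x) ≠ 0 := by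
  rw [volume_dyadicCube]
  exact pow_ne_zero _ (by simp)

lemma dyadicCube_subset_of_le (h : N ≤ m) : dyadicCube m x ⊆ dyadicCube N x := by
  intro y hy i
  obtain ⟨k, rfl⟩ := Nat.exists_eq_add_of_le h
  have key : ∀ t : ℝ, ⌊(2 : ℝ) ^ N * t⌋ = ⌊(2 : ℝ) ^ (N + k) * t⌋ / ((2 ^ k : ℕ) : ℤ) := by
    intro t
    rw [← Int.floor_div_natCast]
    congr 1
    push_cast
    rw [pow_add]
    field_simp
  rw [key, key, hy i]

lemma dist_le_of_mem_dyadicCube (hy : y ∈ dyadicCube N x) (hz : z ∈ dyadicCube N x) :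
    dist y z ≤ (2 ^ N)⁻¹ := by
  rw [dyadicCube_eq_pi] at hy hz
  refine (dist_pi_le_iff (by positivity)).2 fun i => ?_
  have h1 := hy i trivial
  have h2 := hz i trivial
  simp only [Set.mem_Ico] at h1 h2
  rw [Real.dist_eq, abs_le]
  constructor <;> linarith

lemma exists_dyadicCube_subset {s : Set (Fin d → ℝ)} (hs : s ∈ nhds x) (N : ℕ) :
    ∃ m, N ≤ m ∧ dyadicCube m x ⊆ s := by
  obtain ⟨δ, hδ, h⟩ := Metric.mem_nhds_iff.1 hs
  obtain ⟨k, hk⟩ := exists_pow_lt_of_lt_one hδ (by norm_num : (1 / 2 : ℝ) < 1)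
  refine ⟨max N k, le_max_left _ _, fun y hy => h ?_⟩
  refine (dist_le_of_mem_dyadicCube hy mem_dyadicCube_self).trans_lt (lt_of_le_of_lt ?_ hk)
  rw [one_div, inv_pow]
  gcongr
  · norm_num
  · exact le_max_right _ _

lemma countable_range_dyadicCube :
    (Set.range fun p : ℕ × (Fin d → ℝ) => dyadicCube p.1 p.2).Countable := by
  let F : ℕ × (Fin d → ℤ) → Set (Fin d → ℝ) := fun q => {y | ∀ i, ⌊(2 : ℝ) ^ q.1 * y i⌋ = q.2 i}
  refine (Set.countable_range F).mono ?_
  rintro _ ⟨⟨N, x⟩, rfl⟩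
  exact ⟨(N, fun i => ⌊(2 : ℝ) ^ N * x i⌋), rfl⟩

/-- A stopping-time argument on the dyadic grid: if every point of `B` in a cube lies in some
smaller cube in which `B` has relative measure at most `a`, then `B` has relative measure at most
`a` in the whole cube. The cubes in which the estimate holds for the first time are disjoint. -/
lemma measure_inter_dyadicCube_le {a : ENNReal} {B : Set (Fin d → ℝ)} (x : Fin d → ℝ) (N : ℕ)
    (hB : ∀ y ∈ B, y ∈ dyadicCube N x → ∃ m, N ≤ m ∧
      volume (B ∩ dyadicCube m y) ≤ a * volume (dyadicCube m y)) :
    volume (B ∩ dyadicCube N x) ≤ a * volume (dyadicCube N x) := by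
  classical
  let good : ℕ → (Fin d → ℝ) → Prop := fun m y => N ≤ m ∧
    volume (B ∩ dyadicCube m y) ≤ a * volume (dyadicCube m y)
  let first : ℕ → (Fin d → ℝ) → Prop := fun m y => good m y ∧ ∀ k < m, ¬ good k y
  have hfirst : ∀ {m y z}, z ∈ dyadicCube m y → first m y → first m z := by
    intro m y z hz h
    have hg : ∀ k ≤ m, good k z ↔ good k y := fun k hk => by
      simp only [good, dyadicCube_eq_of_mem (dyadicCube_subset_of_le hk hz)]
    exact ⟨(hg m le_rfl).2 h.1, fun k hk => by rw [hg k hk.le]; exact h.2 k hk⟩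
  let 𝒞 : Set (Set (Fin d → ℝ)) :=
    {Q | ∃ m y, y ∈ dyadicCube N x ∧ first m y ∧ Q = dyadicCube m y}
  have hcount : 𝒞.Countable := countable_range_dyadicCube.mono <| by
    rintro _ ⟨m, y, -, -, rfl⟩
    exact ⟨(m, y), rfl⟩
  have hdisj : 𝒞.PairwiseDisjoint id := by
    rintro _ ⟨m, y, -, hm, rfl⟩ _ ⟨k, z, -, hk, rfl⟩ hne
    by_contra hnd
    obtain ⟨w, hw1, hw2⟩ := Set.not_disjoint_iff.1 hnd
    have h1 := hfirst hw1 hm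
    have h2 := hfirst hw2 hk
    have hmk : m = k := by
      rcases lt_trichotomy m k with h | h | h
      · exact absurd h1.1 (h2.2 m h)
      · exact h
      · exact absurd h2.1 (h1.2 k h)
    subst hmk
    exact hne ((dyadicCube_eq_of_mem hw1).symm.trans (dyadicCube_eq_of_mem hw2))
  have hcover : B ∩ dyadicCube N x ⊆ ⋃ Q ∈ 𝒞, B ∩ Q := by
    rintro y ⟨hyB, hyx⟩
    have hex : ∃ m, good m y := hB y hyB hyx
    refine Set.mem_biUnion (x := dyadicCube (Nat.find hex) y) ?_ ⟨hyB, mem_dyadicCube_self⟩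
    exact ⟨_, y, hyx, ⟨Nat.find_spec hex, fun k hk => Nat.find_min hex hk⟩, rfl⟩
  have hsub : ⋃ Q ∈ 𝒞, Q ⊆ dyadicCube N x := by
    refine Set.iUnion₂_subset ?_
    rintro _ ⟨m, y, hyx, hm, rfl⟩
    rw [← dyadicCube_eq_of_mem hyx]
    exact dyadicCube_subset_of_le hm.1.1
  have := hcount.to_subtype
  calc volume (B ∩ dyadicCube N x) ≤ volume (⋃ Q ∈ 𝒞, B ∩ Q) := measure_mono hcover
    _ ≤ ∑' Q : 𝒞, volume (B ∩ (Q : Set (Fin d → ℝ))) := measure_biUnion_le _ hcount _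
    _ ≤ ∑' Q : 𝒞, a * volume (Q : Set (Fin d → ℝ)) := by
        refine ENNReal.tsum_le_tsum ?_
        rintro ⟨_, m, y, -, hm, rfl⟩
        exact hm.1.2
    _ = a * volume (⋃ Q ∈ 𝒞, Q) := by
        rw [ENNReal.tsum_mul_left]
        congr 1
        refine (measure_biUnion hcount hdisj ?_).symm
        rintro _ ⟨m, y, -, -, rfl⟩
        exact measurableSet_dyadicCube
    _ ≤ a * volume (dyadicCube N x) := by gcongr

end DyadicCube

/-! ### Quantitative nondivergence on a poset -/

/-- The finite set `F'` of elements of a poset protects the point `y` relative to `F ⊆ F'`: it is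
a chain, the values at `y` of the new members lie in `[ε, ρ]`, and the values of all elements
outside `F'` that are comparable with all of `F'` are at least `ρ`. -/
structure IsProtecting {P X : Type*} [PartialOrder P] (ψ : P → X → ℝ) (ε ρ : ℝ) (F F' : Finset P)
    (y : X) : Prop where
  subset : F ⊆ F'
  chain : IsChain (· ≤ ·) (F' : Set P)
  mem_Icc : ∀ p ∈ F', p ∉ F → ψ p y ∈ Set.Icc ε ρ
  le_of_comparable : ∀ p ∉ F', (∀ q ∈ F', p ≤ q ∨ q ≤ p) → ρ ≤ ψ p y

/-- The points that are not protected by any chain containing `F`. -/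
def unprotected {P X : Type*} [PartialOrder P] (ψ : P → X → ℝ) (ε ρ : ℝ) (F : Finset P) : Set X :=
  {y | ¬ ∃ F' : Finset P, IsProtecting ψ ε ρ F F' y}

/-- **Quantitative nondivergence on a poset**, in the form suited to induction on the length of
the chain `F`. Around a point where some `ψ p` is below `ρ`, take the largest dyadic cube on which
this is so for some `p`: its parent satisfies the hypotheses for the longer chain `F ∪ {p}`. -/
theorem volume_unprotected_le {d : ℕ} {P : Type*} [PartialOrder P] (rk : P → ℕ)
    (hrk : StrictMono rk) {K : ℕ} (hK : ∀ p, rk p < K) (ψ : P → (Fin d → ℝ) → ℝ) {ε ρ : ℝ}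
    {b : ENNReal} {x₀ : Fin d → ℝ} {N₀ : ℕ}
    (hcont : ∀ p, ∀ x ∈ dyadicCube N₀ x₀, ContinuousAt (ψ p) x)
    (hgood : ∀ p N x, N₀ ≤ N → x ∈ dyadicCube N₀ x₀ → (∃ y ∈ dyadicCube N x, ρ ≤ ψ p y) →
      volume ({y | ψ p y < ε} ∩ dyadicCube N x) ≤ b * volume (dyadicCube N x))
    (m : ℕ) (F : Finset P) (hF : IsChain (· ≤ ·) (F : Set P)) (hm : F.card + m = K + 1)
    (N : ℕ) (x : Fin d → ℝ) (hN : N₀ ≤ N) (hx : x ∈ dyadicCube N₀ x₀)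
    (hsup : ∀ p ∉ F, (∀ q ∈ F, p ≤ q ∨ q ≤ p) → ∃ y ∈ dyadicCube N x, ρ ≤ ψ p y) :
    volume (unprotected ψ ε ρ F ∩ dyadicCube N x) ≤
      (m * (2 ^ d) ^ m * b) * volume (dyadicCube N x) := by
  classical
  induction m generalizing F N x with
  | zero =>
    exfalso
    have hinj : Set.InjOn rk F := by
      intro p hp q hq h
      rcases hF.total hp hq with h' | h'
      · exact h'.eq_of_not_lt fun hlt => (hrk hlt).ne h
      · exact (h'.eq_of_not_lt fun hlt => (hrk hlt).ne h.symm).symm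
    have := Finset.card_le_card_of_injOn (t := Finset.range K) rk
      (fun p _ => by simpa using hK p) hinj
    rw [Finset.card_range] at this
    omega
  | succ m ih =>
    -- `low k y`: on the cube of level `k` around `y` some admissible `ψ p` is everywhere below `ρ`
    let low : ℕ → (Fin d → ℝ) → Prop := fun k y => N ≤ k ∧
      ∃ p ∉ F, (∀ q ∈ F, p ≤ q ∨ q ≤ p) ∧ ∀ z ∈ dyadicCube k y, ψ p z < ρ
    refine measure_inter_dyadicCube_le x N fun y hy hyx => ?_
    have hcube : ∀ k, N ≤ k → dyadicCube k y ⊆ dyadicCube N₀ x₀ := by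
      intro k hk
      rw [← dyadicCube_eq_of_mem hx]
      refine (dyadicCube_subset_of_le hk).trans ?_
      rw [dyadicCube_eq_of_mem hyx]
      exact dyadicCube_subset_of_le hN
    have hlow : ∃ k, low k y := by
      by_contra hno
      refine hy ⟨F, subset_rfl, hF, fun p hp hp' => absurd hp hp', fun p hp hcomp => ?_⟩
      by_contra! hlt
      have hnhds : {z | ψ p z < ρ} ∈ nhds y :=
        (hcont p y (hcube N le_rfl mem_dyadicCube_self)).eventually_lt_const hlt
      obtain ⟨k, hk, hk'⟩ := exists_dyadicCube_subset hnhds N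
      exact hno ⟨k, hk, p, hp, hcomp, hk'⟩
    obtain ⟨⟨hNk, p, hpF, hcomp, hlt⟩, hmin⟩ :=
      And.intro (Nat.find_spec hlow) fun k => Nat.find_min hlow (m := k)
    have hNk' : N ≠ Nat.find hlow := by
      intro h
      obtain ⟨z, hz, hzρ⟩ := hsup p hpF hcomp
      rw [← dyadicCube_eq_of_mem hyx, h] at hz
      exact absurd (hlt z hz) hzρ.not_gt
    obtain ⟨k, hk⟩ : ∃ k, Nat.find hlow = k + 1 :=
      Nat.exists_eq_succ_of_ne_zero (by omega)
    rw [hk] at hNk hlt hmin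
    have hNk1 : N ≤ k := by omega
    have hy₀ : y ∈ dyadicCube N₀ x₀ := hcube N le_rfl mem_dyadicCube_self
    have hnotlow : ∀ q ∉ F, (∀ q' ∈ F, q ≤ q' ∨ q' ≤ q) → ∃ z ∈ dyadicCube k y, ρ ≤ ψ q z := by
      intro q hq hq'
      by_contra! hno
      exact hmin k (Nat.lt_succ_self k) ⟨hNk1, q, hq, hq', hno⟩
    have hF1 : IsChain (· ≤ ·) ((insert p F : Finset P) : Set P) := by
      rw [Finset.coe_insert]
      exact hF.insert fun q hq _ => hcomp q hq
    have hrec := ih (insert p F) hF1 (by rw [Finset.card_insert_of_notMem hpF]; omega) k y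
      (hN.trans hNk1) hy₀ fun q hq hq' => hnotlow q (fun h => hq (Finset.mem_insert_of_mem h))
        fun q' h => hq' q' (Finset.mem_insert_of_mem h)
    have hsmall := hgood p k y (hN.trans hNk1) hy₀ (hnotlow p hpF hcomp)
    have hsub : unprotected ψ ε ρ F ∩ dyadicCube (k + 1) y ⊆
        ({z | ψ p z < ε} ∩ dyadicCube k y) ∪
          (unprotected ψ ε ρ (insert p F) ∩ dyadicCube k y) := by
      rintro z ⟨hz, hzk⟩
      have hzk' := dyadicCube_subset_of_le (Nat.le_succ k) hzk
      by_cases hzε : ψ p z < ε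
      · exact Or.inl ⟨hzε, hzk'⟩
      · refine Or.inr ⟨fun ⟨F', hF'⟩ => hz ⟨F', ?_⟩, hzk'⟩
        refine ⟨(Finset.subset_insert _ _).trans hF'.subset, hF'.chain, fun q hq hqF => ?_,
          hF'.le_of_comparable⟩
        rcases eq_or_ne q p with rfl | hqp
        · exact ⟨not_lt.1 hzε, (hlt z hzk).le⟩
        · exact hF'.mem_Icc q hq (by simp [hqp, hqF])
    refine ⟨k + 1, hNk, ?_⟩
    calc volume (unprotected ψ ε ρ F ∩ dyadicCube (k + 1) y)
        ≤ b * volume (dyadicCube k y) + (m * (2 ^ d) ^ m * b) * volume (dyadicCube k y) :=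
          (measure_mono hsub).trans ((measure_union_le _ _).trans (add_le_add hsmall hrec))
      _ = 2 ^ d * (1 * b + m * (2 ^ d) ^ m * b) * volume (dyadicCube (k + 1) y) := by
          rw [← add_mul, volume_dyadicCube_eq_succ (y := y), one_mul]; ring
      _ ≤ 2 ^ d * ((2 ^ d) ^ m * b + m * (2 ^ d) ^ m * b) * volume (dyadicCube (k + 1) y) := by
          gcongr
          exact one_le_pow₀ (one_le_pow₀ one_le_two)
      _ = _ := by push_cast; ring

/-! ### Sublevel sets in one variable -/

/-- The constants in the one-variable sublevel set estimate. -/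
def sublevelConst : ℕ → ℝ
  | 0 => 0
  | 1 => 2
  | j + 2 => 2 + 2 * sublevelConst (j + 1)

lemma sublevelConst_nonneg : ∀ j, 0 ≤ sublevelConst j
  | 0 => le_rfl
  | 1 => zero_le_two
  | j + 2 => by
      have := sublevelConst_nonneg (j + 1)
      simp only [sublevelConst]; positivity

lemma mul_sub_le_of_deriv_ge {φ φ' : ℝ → ℝ} {I : Set ℝ} (hI : I.OrdConnected)
    (hφ : ∀ s ∈ I, HasDerivAt φ (φ' s) s) {A : ℝ} (hφ' : ∀ s ∈ I, A ≤ φ' s) {s t : ℝ}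
    (hs : s ∈ I) (ht : t ∈ I) (hst : s ≤ t) : A * (t - s) ≤ φ t - φ s := by
  refine Convex.mul_sub_le_image_sub_of_le_deriv (D := Set.Icc s t) (convex_Icc s t)
    (fun r hr => (hφ r (hI.out hs ht hr)).continuousAt.continuousWithinAt)
    (fun r hr => (hφ r (hI.out hs ht (interior_subset hr))).differentiableAt.differentiableWithinAt)
    (fun r hr => ?_) s ⟨le_rfl, hst⟩ t ⟨hst, le_rfl⟩ hst
  rw [(hφ r (hI.out hs ht (interior_subset hr))).deriv]
  exact hφ' r (hI.out hs ht (interior_subset hr))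

/-- A function with derivative at least `A` stays in `(-δ, δ)` on a set of diameter at most
`2δ/A`. -/
lemma volume_abs_lt_le_of_deriv_ge {φ φ' : ℝ → ℝ} {I : Set ℝ} (hI : I.OrdConnected)
    (hφ : ∀ s ∈ I, HasDerivAt φ (φ' s) s) {A δ : ℝ} (hA : 0 < A) (hφ' : ∀ s ∈ I, A ≤ φ' s) :
    volume {s ∈ I | |φ s| < δ} ≤ ENNReal.ofReal (2 * δ / A) := by
  refine (Real.volume_le_diam _).trans (Metric.ediam_le_of_forall_dist_le fun s hs t ht => ?_)
  wlog hst : s ≤ t generalizing s t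
  · rw [dist_comm]
    exact this t ht s hs (le_of_not_ge hst)
  rw [dist_comm, Real.dist_eq, abs_of_nonneg (by linarith), le_div_iff₀ hA]
  have := mul_sub_le_of_deriv_ge hI hφ hφ' hs.1 ht.1 hst
  have h1 := abs_lt.1 hs.2
  have h2 := abs_lt.1 ht.2
  nlinarith

/-- **Sublevel set estimate in one variable**: a function whose `j`-th derivative is at least `A`
on an interval is smaller than `ε` only on a set of measure `O((ε/A)^(1/j))`. By monotonicity of
the derivative of order `j - 1`, that derivative is at least `δ` in absolute value off an interval
of length `2δ/A`; the complement consists of two intervals, to which induction applies. -/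
theorem volume_sublevel_le (j : ℕ) (hj : 1 ≤ j) (Φ : ℕ → ℝ → ℝ) {I : Set ℝ} (hI : I.OrdConnected)
    (hΦ : ∀ i < j, ∀ s ∈ I, HasDerivAt (Φ i) (Φ (i + 1) s) s) {A ε : ℝ} (hA : 0 < A) (hε : 0 < ε)
    (hge : ∀ s ∈ I, A ≤ Φ j s) :
    volume {s ∈ I | |Φ 0 s| < ε} ≤
      ENNReal.ofReal (sublevelConst j * (ε / A) ^ (1 / (j : ℝ))) := by
  induction j, hj using Nat.le_induction generalizing Φ I A with
  | base =>
    refine (volume_abs_lt_le_of_deriv_ge hI (hΦ 0 zero_lt_one) hA hge).trans (le_of_eq ?_)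
    simp [sublevelConst, mul_div_assoc]
  | succ j hj ih =>
    have hj0 : (0 : ℝ) < j := by exact_mod_cast hj
    set τ : ℝ := (ε / A) ^ (1 / ((j + 1 : ℕ) : ℝ)) with hτ
    have hεA : 0 < ε / A := div_pos hε hA
    have hτ0 : 0 < τ := Real.rpow_pos_of_pos hεA _
    -- the choice of `δ` that balances the two contributions
    set δ : ℝ := A * τ with hδ
    have hδ0 : 0 < δ := mul_pos hA hτ0
    have hτδ : (ε / δ) ^ (1 / (j : ℝ)) = τ := by
      have h1 : ε / δ = τ ^ (j : ℝ) := by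
        have h2 : τ ^ ((j : ℝ) + 1) = ε / A := by
          rw [hτ, ← Real.rpow_mul hεA.le]
          push_cast
          rw [one_div_mul_cancel (by positivity), Real.rpow_one]
        rw [Real.rpow_add hτ0, Real.rpow_one] at h2
        rw [hδ, ← div_div, ← h2]
        field_simp
      rw [h1, ← Real.rpow_mul hτ0.le, mul_one_div_cancel hj0.ne', Real.rpow_one]
    have hmono : MonotoneOn (Φ j) I := by
      intro s hs t ht hst
      have := mul_sub_le_of_deriv_ge hI (hΦ j (Nat.lt_succ_self j)) hge hs ht hst
      nlinarith
    let I₁ : Set ℝ := {s ∈ I | δ ≤ Φ j s}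
    let I₂ : Set ℝ := {s ∈ I | δ ≤ - Φ j s}
    have hI₁ : I₁.OrdConnected := ⟨fun s hs t ht r hr =>
      ⟨hI.out hs.1 ht.1 hr, hs.2.trans (hmono hs.1 (hI.out hs.1 ht.1 hr) hr.1)⟩⟩
    have hI₂ : I₂.OrdConnected := ⟨fun s hs t ht r hr =>
      ⟨hI.out hs.1 ht.1 hr, ht.2.trans (neg_le_neg (hmono (hI.out hs.1 ht.1 hr) ht.1 hr.2))⟩⟩
    have e₀ := volume_abs_lt_le_of_deriv_ge (δ := δ) hI (hΦ j (Nat.lt_succ_self j)) hA hge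
    have e₁ := ih Φ hI₁ (fun i hi s hs => hΦ i (by omega) s hs.1) hδ0 fun s hs => hs.2
    have e₂ := ih (fun i s => - Φ i s) hI₂ (fun i hi s hs => (hΦ i (by omega) s hs.1).neg) hδ0
      fun s hs => hs.2
    rw [hτδ] at e₁ e₂
    have hsub : {s ∈ I | |Φ 0 s| < ε} ⊆
        {s ∈ I | |Φ j s| < δ} ∪ ({s ∈ I₁ | |Φ 0 s| < ε} ∪ {s ∈ I₂ | |-Φ 0 s| < ε}) := by
      rintro s ⟨hs, hsε⟩
      rcases lt_or_ge |Φ j s| δ with h | h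
      · exact Or.inl ⟨hs, h⟩
      · rcases le_abs.1 h with h | h
        · exact Or.inr (Or.inl ⟨⟨hs, h⟩, hsε⟩)
        · exact Or.inr (Or.inr ⟨⟨hs, h⟩, by rwa [abs_neg]⟩)
    refine (measure_mono hsub).trans ((measure_union_le _ _).trans
      ((add_le_add e₀ ((measure_union_le _ _).trans (add_le_add e₁ e₂))).trans ?_))
    have hC := sublevelConst_nonneg j
    rw [← ENNReal.ofReal_add (by positivity) (by positivity),
      ← ENNReal.ofReal_add (by positivity) (by positivity)]
    refine ENNReal.ofReal_le_ofReal (le_of_eq ?_)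
    obtain ⟨i, rfl⟩ := Nat.exists_eq_add_of_le' hj
    simp only [sublevelConst]
    rw [hδ]
    field_simp
    ring

/-! ### Symmetry of higher derivatives and polarization -/

section Symmetry

variable {E F : Type*} [NormedAddCommGroup E] [NormedSpace ℝ E] [NormedAddCommGroup F]
  [NormedSpace ℝ F]

lemma iteratedFDeriv_comp_swap_succ {f : E → F} {x : E} {k : ℕ}
    (hf : ContDiffAt ℝ (k + 1 : ℕ) f x) (i : Fin k) (m : Fin (k + 1) → E) :
    iteratedFDeriv ℝ (k + 1) f x (m ∘ Equiv.swap i.castSucc i.succ) =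
      iteratedFDeriv ℝ (k + 1) f x m := by
  induction k generalizing x with
  | zero => exact i.elim0
  | succ k ih =>
    have hlt : ((k + 1 : ℕ) : WithTop ℕ∞) < (k + 1 + 1 : ℕ) := by
      exact_mod_cast Nat.lt_succ_self _
    have hdiff : DifferentiableAt ℝ (iteratedFDeriv ℝ (k + 1) f) x :=
      hf.differentiableAt_iteratedFDeriv hlt
    rw [hdiff.iteratedFDeriv_succ_apply_left', hdiff.iteratedFDeriv_succ_apply_left']
    induction i using Fin.cases with
    | zero =>
      -- the second derivative of the derivative of order `k` is symmetric
      have h2 : ContDiffAt ℝ 2 (iteratedFDeriv ℝ k f) x := by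
        refine hf.iteratedFDeriv_right ?_
        exact_mod_cast (show 2 + k ≤ k + 1 + 1 by omega)
      have hsymm := h2.isSymmSndFDerivAt (by simp)
      have h1 : DifferentiableAt ℝ (fderiv ℝ (iteratedFDeriv ℝ k f)) x :=
        (h2.fderiv_right (m := 1) (by norm_num [one_add_one_eq_two])).differentiableAt one_ne_zero
      have key : ∀ (a b : E) (v : Fin k → E) (w : Fin (k + 1) → E), w 0 = b → Fin.tail w = v →
          fderiv ℝ (fun y => iteratedFDeriv ℝ (k + 1) f y w) x a =
            fderiv ℝ (fderiv ℝ (iteratedFDeriv ℝ k f)) x a b v := by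
        intro a b v w hb hv
        have : (fun y => iteratedFDeriv ℝ (k + 1) f y w) =
            fun y => fderiv ℝ (iteratedFDeriv ℝ k f) y b v := by
          ext y
          rw [iteratedFDeriv_succ_apply_left, hb, hv]
        rw [this]
        have h3 : DifferentiableAt ℝ (fun y => fderiv ℝ (iteratedFDeriv ℝ k f) y b) x :=
          h1.clm_apply (differentiableAt_const b)
        rw [fderiv_continuousMultilinear_apply_const h3]
        simp [fderiv_clm_apply h1 (differentiableAt_const b)]
      rw [key _ (m 0) (Fin.tail (Fin.tail m)), key _ (m 1) (Fin.tail (Fin.tail m)),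
        hsymm.eq]
      · simp
      · rfl
      · rfl
      · simp [Fin.tail]
      · ext j
        simp only [Fin.tail, Function.comp]
        rw [Equiv.swap_apply_of_ne_of_ne]
        · exact Fin.succ_ne_zero _
        · simp [Fin.ext_iff]
    | succ j =>
      have htail : Fin.tail (m ∘ Equiv.swap j.succ.castSucc j.succ.succ) =
          Fin.tail m ∘ Equiv.swap j.castSucc j.succ := by
        ext a
        simp only [Fin.tail, Function.comp]
        congr 1
        simp only [Equiv.swap_apply_def, Fin.ext_iff]
        split_ifs <;> simp_all
      have h0 : (m ∘ Equiv.swap j.succ.castSucc j.succ.succ) 0 = m 0 := by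
        simp only [Function.comp]
        rw [Equiv.swap_apply_of_ne_of_ne]
        · simp [Fin.ext_iff]
        · simp [Fin.ext_iff]
      rw [htail, h0]
      congr 1
      refine Filter.EventuallyEq.fderiv_eq ?_
      have hev : ∀ᶠ y in nhds x, ContDiffAt ℝ (k + 1 : ℕ) f y :=
        (hf.of_le hlt.le).eventually (by simp)
      filter_upwards [hev] with y hy
      exact ih hy j (Fin.tail m)

/-- The derivative of order `k` of a `C^k` function is symmetric. -/
theorem iteratedFDeriv_comp_perm_of_contDiffAt {f : E → F} {x : E} {k : ℕ}
    (hf : ContDiffAt ℝ k f x) (σ : Equiv.Perm (Fin k)) (m : Fin k → E) :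
    iteratedFDeriv ℝ k f x (m ∘ σ) = iteratedFDeriv ℝ k f x m := by
  cases k with
  | zero => congr 1; ext i; exact i.elim0
  | succ k =>
    have hσ : σ ∈ Submonoid.closure
        (Set.range fun i : Fin k => Equiv.swap i.castSucc i.succ) := by
      rw [Equiv.Perm.mclosure_swap_castSucc_succ]; trivial
    induction hσ using Submonoid.closure_induction generalizing m with
    | mem σ h =>
      obtain ⟨i, rfl⟩ := h
      exact iteratedFDeriv_comp_swap_succ hf i m
    | one => rfl
    | mul σ τ _ _ hσ hτ =>
      rw [Equiv.Perm.coe_mul, ← Function.comp_assoc, hτ, hσ]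

/-- **Polarization**: the alternating sum of the diagonal values of a symmetric multilinear map
over all partial sums of `v` recovers the value at `v`. -/
theorem sum_neg_one_pow_mul_diag {k : ℕ} (A : E [×k]→L[ℝ] ℝ)
    (hA : ∀ (σ : Equiv.Perm (Fin k)) (m : Fin k → E), A (m ∘ σ) = A m) (v : Fin k → E) :
    ∑ u : Finset (Fin k), (-1 : ℝ) ^ u.card * A (fun _ => ∑ i ∈ uᶜ, v i) = k.factorial * A v := by
  classical
  have h1 : ∀ u : Finset (Fin k), A (fun _ => ∑ i ∈ uᶜ, v i) =
      ∑ r : Fin k → Fin k, if ∀ j, r j ∈ uᶜ then A (v ∘ r) else 0 := by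
    intro u
    rw [A.map_sum_finset (fun _ => v) fun _ => uᶜ, ← Finset.sum_filter]
    refine Finset.sum_congr ?_ fun r _ => rfl
    ext r
    simp [Fintype.mem_piFinset]
  simp_rw [h1, Finset.mul_sum]
  rw [Finset.sum_comm]
  have h2 : ∀ r : Fin k → Fin k,
      ∑ u : Finset (Fin k), (-1 : ℝ) ^ u.card * (if ∀ j, r j ∈ uᶜ then A (v ∘ r) else 0) =
        if Function.Bijective r then A v else 0 := by
    intro r
    have h3 : ∑ u : Finset (Fin k), (-1 : ℝ) ^ u.card * (if ∀ j, r j ∈ uᶜ then A (v ∘ r) else 0) =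
        (∑ u ∈ ((Finset.univ.image r)ᶜ).powerset, (-1 : ℝ) ^ u.card) * A (v ∘ r) := by
      rw [Finset.sum_mul]
      simp only [mul_ite, mul_zero]
      rw [← Finset.sum_filter]
      refine Finset.sum_congr ?_ fun u _ => rfl
      ext u
      simp only [Finset.mem_filter, Finset.mem_univ, true_and, Finset.mem_powerset,
        Finset.mem_compl, Finset.subset_iff, Finset.mem_image, not_exists]
      exact ⟨fun h a ha j hj => h j (hj ▸ ha), fun h j hj => h hj j rfl⟩
    have h4 : (∑ u ∈ ((Finset.univ.image r)ᶜ).powerset, (-1 : ℝ) ^ u.card) =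
        if (Finset.univ.image r)ᶜ = ∅ then 1 else 0 := by
      exact_mod_cast congrArg (Int.cast : ℤ → ℝ)
        (Finset.sum_powerset_neg_one_pow_card (x := (Finset.univ.image r)ᶜ))
    rw [h3, h4]
    have h5 : (Finset.univ.image r)ᶜ = ∅ ↔ Function.Bijective r := by
      rw [← Finite.surjective_iff_bijective, Finset.compl_eq_empty_iff, Finset.eq_univ_iff_forall]
      simp [Function.Surjective]
    by_cases hr : Function.Bijective r
    · rw [if_pos (h5.2 hr), if_pos hr, one_mul]
      exact hA (Equiv.ofBijective r hr) v
    · rw [if_neg (fun h => hr (h5.1 h)), if_neg hr, zero_mul]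
  rw [Finset.sum_congr rfl fun r _ => h2 r, ← Finset.sum_filter, Finset.sum_const, nsmul_eq_mul]
  congr 2
  have h6 := Fintype.card_perm (α := Fin k)
  rw [Fintype.card_fin] at h6
  rw [← h6, ← Fintype.card_subtype]
  exact Fintype.card_congr (Equiv.ofBijective (fun r => Equiv.ofBijective r.1 r.2)
    ⟨fun r s h => Subtype.ext (by simpa using congrArg (fun e : Equiv.Perm (Fin k) => ⇑e) h),
      fun e => ⟨⟨e, e.bijective⟩, by ext; rfl⟩⟩)

/-- A symmetric multilinear map takes a diagonal value comparable with its norm. -/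
theorem exists_norm_le_diag {k : ℕ} (A : E [×k]→L[ℝ] ℝ)
    (hA : ∀ (σ : Equiv.Perm (Fin k)) (m : Fin k → E), A (m ∘ σ) = A m) :
    ∃ v : E, ‖v‖ ≤ 1 ∧ ‖A‖ ≤ 2 * (2 * k : ℝ) ^ k * |A fun _ => v| := by
  by_contra! hlt
  have hpos : 0 < ‖A‖ := by
    refine lt_of_le_of_lt ?_ (hlt 0 (by simp))
    positivity
  have hk : 0 < (2 * k : ℝ) ^ k := by
    rcases Nat.eq_zero_or_pos k with rfl | hk
    · simp
    · positivity
  set M : ℝ := ‖A‖ / (2 * (2 * k : ℝ) ^ k) with hM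
  have hM0 : 0 ≤ M := by positivity
  have hdiag : ∀ v : E, |A fun _ => v| ≤ M * ‖v‖ ^ k := by
    intro v
    by_cases hv : v = 0
    · subst hv
      rcases Nat.eq_zero_or_pos k with rfl | hk'
      · have := hlt 0 (by simp)
        simp only [pow_zero, mul_one]
        rw [hM, le_div_iff₀ (by positivity), mul_comm]
        exact this.le
      · rw [A.map_coord_zero ⟨0, hk'⟩ rfl, abs_zero]
        positivity
    · have hv' : ‖v‖ ≠ 0 := norm_ne_zero_iff.2 hv
      have h1 := hlt (‖v‖⁻¹ • v) (by rw [norm_smul, norm_inv, norm_norm, inv_mul_cancel₀ hv'])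
      have h2 : (A fun _ => ‖v‖⁻¹ • v) = (‖v‖⁻¹) ^ k * A fun _ => v := by
        have := A.map_smul_univ (fun _ => ‖v‖⁻¹) (fun _ => v)
        simpa using this
      rw [h2, abs_mul, abs_of_nonneg (by positivity)] at h1
      rw [hM, div_mul_eq_mul_div, le_div_iff₀ (by positivity)]
      have h3 : 0 < ‖v‖ ^ k := by positivity
      rw [inv_pow] at h1
      have h4 := mul_lt_mul_of_pos_right h1 h3
      field_simp at h4
      nlinarith
  have hbound : ‖A‖ ≤ (2 * k : ℝ) ^ k * M := by
    refine A.opNorm_le_bound (by positivity) fun v => ?_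
    by_cases hv : ∃ i, v i = 0
    · obtain ⟨i, hi⟩ := hv
      rw [A.map_coord_zero i hi, norm_zero]
      positivity
    push Not at hv
    -- normalize the arguments
    let w : Fin k → E := fun i => ‖v i‖⁻¹ • v i
    have hw : ∀ i, ‖w i‖ = 1 := fun i => by
      rw [norm_smul, norm_inv, norm_norm, inv_mul_cancel₀ (norm_ne_zero_iff.2 (hv i))]
    have hvw : A v = (∏ i, ‖v i‖) * A w := by
      rw [← smul_eq_mul, ← A.map_smul_univ]
      congr 1
      ext i
      rw [smul_inv_smul₀ (norm_ne_zero_iff.2 (hv i))]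
    have hAw : |A w| ≤ (2 * k : ℝ) ^ k * M := by
      have h1 : (1 : ℝ) ≤ k.factorial := by exact_mod_cast k.factorial_pos
      calc |A w| ≤ k.factorial * |A w| := le_mul_of_one_le_left (abs_nonneg _) h1
        _ = |∑ u : Finset (Fin k), (-1 : ℝ) ^ u.card * A (fun _ => ∑ i ∈ uᶜ, w i)| := by
            rw [sum_neg_one_pow_mul_diag A hA, abs_mul, Nat.abs_cast]
        _ ≤ ∑ u : Finset (Fin k), |(-1 : ℝ) ^ u.card * A (fun _ => ∑ i ∈ uᶜ, w i)| :=
            Finset.abs_sum_le_sum_abs _ _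
        _ ≤ ∑ _u : Finset (Fin k), M * k ^ k := by
            refine Finset.sum_le_sum fun u _ => ?_
            rw [abs_mul, abs_pow, abs_neg, abs_one, one_pow, one_mul]
            refine (hdiag _).trans ?_
            gcongr
            calc ‖∑ i ∈ uᶜ, w i‖ ≤ ∑ i ∈ uᶜ, ‖w i‖ := norm_sum_le _ _
              _ = (uᶜ.card : ℝ) := by simp [hw]
              _ ≤ k := by exact_mod_cast (Finset.card_le_univ _).trans_eq (Fintype.card_fin k)
        _ = (2 * k : ℝ) ^ k * M := by
            rw [Finset.sum_const, Finset.card_univ, Fintype.card_finset, Fintype.card_fin,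
              nsmul_eq_mul, mul_pow]
            push_cast
            ring
    rw [hvw, norm_mul, Real.norm_eq_abs, Real.norm_eq_abs,
      abs_of_nonneg (Finset.prod_nonneg fun i _ => norm_nonneg _), mul_comm]
    gcongr
  have : (2 * k : ℝ) ^ k * M = ‖A‖ / 2 := by
    rw [hM]; field_simp
  linarith

end Symmetry

/-! ### Sublevel sets on dyadic cubes -/

section Averaging

variable {d : ℕ}

/-- If every line in the direction `v` meets a subset `S` of a dyadic cube in a set of measure at
most `m`, then the relative measure of `S` is `O(m / r)`, where `r` is the side of the cube. The
proof averages the measure of `S` over its translates by `s • v`, `0 ≤ s ≤ r`. -/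
lemma volume_mul_side_le_of_lines {N : ℕ} {x : Fin d → ℝ} {S : Set (Fin d → ℝ)}
    (hS : MeasurableSet S) (hSx : S ⊆ dyadicCube N x) {v : Fin d → ℝ} (hv : ‖v‖ ≤ 1) {m : ENNReal}
    (hm : ∀ y, volume {s : ℝ | y + s • v ∈ S} ≤ m) :
    ENNReal.ofReal ((2 ^ N)⁻¹) * volume S ≤ m * (3 ^ d * volume (dyadicCube N x)) := by
  set r : ℝ := (2 ^ N)⁻¹ with hr
  have hr0 : 0 < r := by positivity
  let μ : Measure ℝ := volume.restrict (Set.Icc 0 r)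
  let W : Set (ℝ × (Fin d → ℝ)) := {p | p.2 + p.1 • v ∈ S}
  have hW : MeasurableSet W := by
    have : Measurable fun p : ℝ × (Fin d → ℝ) => p.2 + p.1 • v := by fun_prop
    exact this hS
  have h1 : (μ.prod volume) W = ENNReal.ofReal r * volume S := by
    rw [Measure.prod_apply hW]
    have : ∀ s : ℝ, volume (Prod.mk s ⁻¹' W) = volume S := fun s =>
      measure_preimage_add_right volume (s • v) S
    simp only [this, lintegral_const, μ, Measure.restrict_apply MeasurableSet.univ, Set.univ_inter,
      Real.volume_Icc, sub_zero]
    rw [mul_comm]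
  let big : Set (Fin d → ℝ) := Set.pi Set.univ fun i =>
    Set.Ico ((⌊(2 : ℝ) ^ N * x i⌋ : ℝ) / 2 ^ N - r) ((⌊(2 : ℝ) ^ N * x i⌋ : ℝ) / 2 ^ N + 2 * r)
  have hbig : volume big = 3 ^ d * volume (dyadicCube N x) := by
    rw [Real.volume_pi_Ico, volume_dyadicCube, ← mul_pow,
      show (3 : ENNReal) = ENNReal.ofReal 3 by simp, ← ENNReal.ofReal_mul (by norm_num)]
    rw [Finset.prod_congr rfl fun i _ => ?_]
    · rw [Finset.prod_const, Finset.card_univ, Fintype.card_fin]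
    · congr 1; rw [← hr]; ring
  have hsub : ∀ y ∉ big, μ ((fun s => (s, y)) ⁻¹' W) = 0 := by
    intro y hy
    rw [Measure.restrict_apply (hW.preimage (by fun_prop))]
    convert measure_empty (μ := (volume : Measure ℝ))
    rw [Set.eq_empty_iff_forall_notMem]
    rintro s ⟨hs, hs0, hsr⟩
    refine hy fun i _ => ?_
    have h2 : y + s • v ∈ dyadicCube N x := hSx hs
    rw [dyadicCube_eq_pi] at h2
    have h3 := h2 i trivial
    simp only [Set.mem_Ico, Pi.add_apply, Pi.smul_apply, smul_eq_mul] at h3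
    have h4 : |v i| ≤ 1 := (norm_le_pi_norm v i).trans hv
    have h5 : |s * v i| ≤ r := by
      rw [abs_mul, abs_of_nonneg hs0]
      nlinarith [abs_nonneg (v i)]
    have h6 := abs_le.1 h5
    constructor <;> linarith
  have hmb : MeasurableSet big := MeasurableSet.univ_pi fun i => measurableSet_Ico
  calc ENNReal.ofReal r * volume S = ∫⁻ y, μ ((fun s => (s, y)) ⁻¹' W) := by
        rw [← h1, Measure.prod_apply_symm hW]
    _ ≤ ∫⁻ y, big.indicator (fun _ => m) y := by
        refine lintegral_mono fun y => ?_
        by_cases hy : y ∈ big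
        · rw [Set.indicator_of_mem hy]
          exact (Measure.restrict_apply_le _ _).trans (hm y)
        · rw [hsub y hy]; exact zero_le
    _ = m * (3 ^ d * volume (dyadicCube N x)) := by
        rw [lintegral_indicator hmb, setLIntegral_const, hbig]

end Averaging

section Good

variable {d : ℕ}

/-- The size of the derivatives of `g` of order at most `l` at `x`, at the scale `r`. -/
noncomputable def jetSize (l : ℕ) (r : ℝ) (g : (Fin d → ℝ) → ℝ) (x : Fin d → ℝ) : ℝ :=
  ∑ i ∈ Finset.range (l + 1), r ^ i * ‖iteratedFDeriv ℝ i g x‖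

variable {l N : ℕ} {g : (Fin d → ℝ) → ℝ} {x : Fin d → ℝ}

lemma norm_iteratedFDeriv_sub_le {M i : ℕ} {z w : Fin d → ℝ} {C : ℝ} (hi : i < l)
    (hg : ∀ y ∈ dyadicCube M x, ContDiffAt ℝ l g y)
    (hC : ∀ y ∈ dyadicCube M x, ‖iteratedFDeriv ℝ (i + 1) g y‖ ≤ C)
    (hz : z ∈ dyadicCube M x) (hw : w ∈ dyadicCube M x) :
    ‖iteratedFDeriv ℝ i g z - iteratedFDeriv ℝ i g w‖ ≤ C * (2 ^ M)⁻¹ := by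
  have hC0 : 0 ≤ C := (norm_nonneg _).trans (hC z hz)
  have h := convex_dyadicCube.norm_image_sub_le_of_norm_fderiv_le (𝕜 := ℝ)
    (f := iteratedFDeriv ℝ i g)
    (fun y hy => (hg y hy).differentiableAt_iteratedFDeriv (by exact_mod_cast hi))
    (fun y hy => by rw [norm_fderiv_iteratedFDeriv]; exact hC y hy) hw hz
  refine h.trans ?_
  gcongr
  rw [← dist_eq_norm]
  exact dist_le_of_mem_dyadicCube hz hw

/-- If the derivatives of order `l` are nearly constant on a cube, the derivatives of lower order
are controlled on the cube by the jet at any of its points. -/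
lemma scaled_norm_iteratedFDeriv_le {τ : ℝ} (hg : ∀ y ∈ dyadicCube N x, ContDiffAt ℝ l g y)
    {y z : Fin d → ℝ} (hosc : ∀ z ∈ dyadicCube N x, ((2 : ℝ) ^ N)⁻¹ ^ l *
      ‖iteratedFDeriv ℝ l g z - iteratedFDeriv ℝ l g y‖ ≤ τ * jetSize l (2 ^ N)⁻¹ g y)
    (hτ : τ ≤ 1) (hy : y ∈ dyadicCube N x) (hz : z ∈ dyadicCube N x) {i : ℕ} (hi : i ≤ l) :
    ((2 : ℝ) ^ N)⁻¹ ^ i * ‖iteratedFDeriv ℝ i g z‖ ≤ 2 * jetSize l (2 ^ N)⁻¹ g y := by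
  set r : ℝ := (2 ^ N)⁻¹ with hr
  have hr0 : 0 < r := by positivity
  have hT0 : 0 ≤ jetSize l r g y := Finset.sum_nonneg fun i _ => by positivity
  have key : ∀ k ≤ l, ∀ z ∈ dyadicCube N x, r ^ (l - k) * ‖iteratedFDeriv ℝ (l - k) g z‖ ≤
      ∑ j ∈ Finset.Ico (l - k) (l + 1), r ^ j * ‖iteratedFDeriv ℝ j g y‖ +
        τ * jetSize l r g y := by
    intro k hk
    induction k with
    | zero =>
      intro z hz
      have h1 := hosc z hz
      have h2 := norm_le_norm_add_norm_sub' (iteratedFDeriv ℝ l g z) (iteratedFDeriv ℝ l g y)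
      simp only [Nat.sub_zero, Nat.Ico_succ_singleton, Finset.sum_singleton]
      nlinarith [mul_le_mul_of_nonneg_left h2 (pow_pos hr0 l).le]
    | succ k ih =>
      intro z hz
      have hi : l - (k + 1) + 1 = l - k := by omega
      set i := l - (k + 1) with hi'
      set B : ℝ := ∑ j ∈ Finset.Ico (i + 1) (l + 1), r ^ j * ‖iteratedFDeriv ℝ j g y‖ +
        τ * jetSize l r g y with hB
      have h1 : ∀ w ∈ dyadicCube N x, ‖iteratedFDeriv ℝ (i + 1) g w‖ ≤ B / r ^ (i + 1) := by
        intro w hw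
        rw [le_div_iff₀ (by positivity), mul_comm]
        have := ih (by omega) w hw
        rwa [← hi] at this
      have h2 := norm_iteratedFDeriv_sub_le (by omega : i < l) hg h1 hz hy
      have h3 := norm_le_norm_add_norm_sub' (iteratedFDeriv ℝ i g z) (iteratedFDeriv ℝ i g y)
      rw [Finset.sum_eq_sum_Ico_succ_bot (by omega : i < l + 1), add_assoc, ← hB]
      calc r ^ i * ‖iteratedFDeriv ℝ i g z‖
          ≤ r ^ i * (‖iteratedFDeriv ℝ i g y‖ + B / r ^ (i + 1) * r) := by
            gcongr; exact h3.trans (by gcongr)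
        _ = _ := by rw [mul_add, pow_succ]; field_simp
  have h := key (l - i) (by omega) z hz
  rw [Nat.sub_sub_self hi] at h
  have h2 : ∑ j ∈ Finset.Ico i (l + 1), r ^ j * ‖iteratedFDeriv ℝ j g y‖ ≤ jetSize l r g y := by
    unfold jetSize
    rw [Finset.range_eq_Ico]
    exact Finset.sum_le_sum_of_subset_of_nonneg (Finset.Ico_subset_Ico_left (Nat.zero_le _))
      fun j _ _ => by positivity
  nlinarith

lemma hasDerivAt_iteratedFDeriv_line {i : ℕ} (hi : i < l) {y v : Fin d → ℝ} {s : ℝ}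
    (hg : ContDiffAt ℝ l g (y + s • v)) :
    HasDerivAt (fun s : ℝ => iteratedFDeriv ℝ i g (y + s • v) fun _ => v)
      (iteratedFDeriv ℝ (i + 1) g (y + s • v) fun _ => v) s := by
  have h1 : HasFDerivAt (iteratedFDeriv ℝ i g) (fderiv ℝ (iteratedFDeriv ℝ i g) (y + s • v))
      (y + s • v) := (hg.differentiableAt_iteratedFDeriv (by exact_mod_cast hi)).hasFDerivAt
  have h2 : HasDerivAt (fun s : ℝ => y + s • v) v s := by
    simpa using ((hasDerivAt_id s).smul_const v).const_add y
  have h3 := h1.comp_hasDerivAt s h2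
  have h4 := ((ContinuousMultilinearMap.apply ℝ (fun _ : Fin i => Fin d → ℝ) ℝ
    (fun _ => v)).hasFDerivAt (x := iteratedFDeriv ℝ i g (y + s • v))).comp_hasDerivAt s h3
  exact h4

/-- The sublevel set estimate on a cube on which a pure directional derivative of order `j` is
large. -/
lemma volume_sublevel_inter_cube_le {j : ℕ} (hj : 1 ≤ j) {v : Fin d → ℝ} (hv : ‖v‖ ≤ 1)
    {A ε : ℝ} (hA : 0 < A) (hε : 0 < ε) (hg : ∀ y ∈ dyadicCube N x, ContDiffAt ℝ j g y)
    (hge : (∀ y ∈ dyadicCube N x, A ≤ iteratedFDeriv ℝ j g y fun _ => v) ∨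
      ∀ y ∈ dyadicCube N x, A ≤ -iteratedFDeriv ℝ j g y fun _ => v) :
    ENNReal.ofReal ((2 ^ N)⁻¹) * volume ({y | |g y| < ε} ∩ dyadicCube N x) ≤
      ENNReal.ofReal (sublevelConst j * (ε / A) ^ (1 / (j : ℝ))) *
        (3 ^ d * volume (dyadicCube N x)) := by
  have hcont : ContinuousOn g (dyadicCube N x) := fun y hy =>
    (hg y hy).continuousAt.continuousWithinAt
  have hmeas : MeasurableSet ({y | |g y| < ε} ∩ dyadicCube N x) := by
    obtain ⟨u, hu, hu'⟩ := (continuousOn_iff'.1 hcont) (Metric.ball 0 ε) Metric.isOpen_ball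
    have : {y | |g y| < ε} ∩ dyadicCube N x = u ∩ dyadicCube N x := by
      rw [← hu']
      ext y
      simp
    rw [this]
    exact hu.measurableSet.inter measurableSet_dyadicCube
  refine volume_mul_side_le_of_lines hmeas Set.inter_subset_right hv fun y => ?_
  let I : Set ℝ := {s | y + s • v ∈ dyadicCube N x}
  have hI : I.OrdConnected := by
    have : Convex ℝ I := by
      intro s hs t ht a b ha hb hab
      have := convex_dyadicCube hs ht ha hb hab
      simp only [I, Set.mem_ofPred_eq]
      convert this using 1
      simp only [smul_add, add_smul, smul_smul, smul_eq_mul]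
      nth_rewrite 1 [← one_smul ℝ y, ← hab]
      rw [add_smul]
      abel
    exact this.ordConnected
  rcases hge with hge | hge
  · have h := volume_sublevel_le j hj (fun i s => iteratedFDeriv ℝ i g (y + s • v) fun _ => v) hI
      (fun i hi s hs => hasDerivAt_iteratedFDeriv_line hi (hg _ hs)) hA hε fun s hs => hge _ hs
    refine (measure_mono ?_).trans h
    rintro s ⟨hs, hs'⟩
    exact ⟨hs', by simpa using hs⟩
  · have h := volume_sublevel_le j hj (fun i s => -iteratedFDeriv ℝ i g (y + s • v) fun _ => v) hI
      (fun i hi s hs => (hasDerivAt_iteratedFDeriv_line hi (hg _ hs)).neg) hA hε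
      fun s hs => hge _ hs
    refine (measure_mono ?_).trans h
    rintro s ⟨hs, hs'⟩
    exact ⟨hs', by simpa using hs⟩

end Good

section Good

variable {d : ℕ}

/-- At a point where the jet of `g` is of size `T`, some pure directional derivative of order
`j ≤ l` has, after rescaling, size comparable with `T`. -/
lemma exists_diag_iteratedFDeriv_ge {l : ℕ} {r : ℝ} (hr : 0 < r) {g : (Fin d → ℝ) → ℝ}
    {x : Fin d → ℝ} (hg : ContDiffAt ℝ l g x) :
    ∃ j ≤ l, ∃ v : Fin d → ℝ, ‖v‖ ≤ 1 ∧ jetSize l r g x ≤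
      (l + 1) * (2 * (2 * l + 2) ^ l) * (r ^ j * |iteratedFDeriv ℝ j g x fun _ => v|) := by
  obtain ⟨j, hj, hjmax⟩ := Finset.exists_max_image (Finset.range (l + 1))
    (fun i => r ^ i * ‖iteratedFDeriv ℝ i g x‖) ⟨0, by simp⟩
  have hjl : j ≤ l := Nat.lt_succ_iff.1 (Finset.mem_range.1 hj)
  have hT : jetSize l r g x ≤ (l + 1) * (r ^ j * ‖iteratedFDeriv ℝ j g x‖) := by
    have := Finset.sum_le_card_nsmul _ _ _ hjmax
    simpa [jetSize] using this
  obtain ⟨v, hv, hvn⟩ := exists_norm_le_diag (iteratedFDeriv ℝ j g x) fun σ m =>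
    iteratedFDeriv_comp_perm_of_contDiffAt (hg.of_le (by exact_mod_cast hjl)) σ m
  refine ⟨j, hjl, v, hv, hT.trans ?_⟩
  have hpow : (2 * j : ℝ) ^ j ≤ (2 * l + 2) ^ l := by
    have h1 : (2 * j : ℝ) ≤ 2 * l + 2 := by
      have : (j : ℝ) ≤ l := by exact_mod_cast hjl
      linarith
    have h2 : (1 : ℝ) ≤ 2 * l + 2 := by
      have : (0 : ℝ) ≤ l := Nat.cast_nonneg l
      linarith
    exact (pow_le_pow_left₀ (by positivity) h1 j).trans (pow_le_pow_right₀ h2 hjl)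
  calc (l + 1) * (r ^ j * ‖iteratedFDeriv ℝ j g x‖)
      ≤ (l + 1) * (r ^ j * (2 * (2 * l + 2) ^ l * |iteratedFDeriv ℝ j g x fun _ => v|)) := by
        gcongr
        exact hvn.trans (by gcongr)
    _ = _ := by ring

/-- **Sublevel set estimate on dyadic cubes** for functions whose derivatives of order `l` are
nearly constant relative to the size of the jet. The cube is divided into boundedly many smaller
cubes, on each of which one pure directional derivative is bounded below. -/
theorem exists_volume_sublevel_le (d : ℕ) {l : ℕ} (hl : 1 ≤ l) :
    ∃ τ κ C : ℝ, 0 < τ ∧ τ ≤ 1 ∧ 0 < κ ∧ 0 < C ∧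
      ∀ (g : (Fin d → ℝ) → ℝ) (N : ℕ) (x : Fin d → ℝ),
      (∀ y ∈ dyadicCube N x, ContDiffAt ℝ l g y) →
      (∀ y ∈ dyadicCube N x, 0 < jetSize l (2 ^ N)⁻¹ g y) →
      (∀ y ∈ dyadicCube N x, ∀ z ∈ dyadicCube N x, ((2 : ℝ) ^ N)⁻¹ ^ l *
        ‖iteratedFDeriv ℝ l g z - iteratedFDeriv ℝ l g y‖ ≤ τ * jetSize l (2 ^ N)⁻¹ g y) →
      ∀ y ∈ dyadicCube N x, ∀ ε : ℝ, 0 < ε →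
        volume ({y | |g y| < ε} ∩ dyadicCube N x) ≤
          ENNReal.ofReal (C * (ε / (κ * jetSize l (2 ^ N)⁻¹ g y)) ^ (1 / (l : ℝ))) *
            volume (dyadicCube N x) := by
  have hl0 : (0 : ℝ) < l := by exact_mod_cast hl
  set P : ℝ := (l + 1) * (2 * (2 * l + 2) ^ l) with hP
  have hP0 : 0 < P := by positivity
  -- `κ` is half of the lower bound for the pure derivatives at given points of the small cubes
  set κ : ℝ := (2 * (l + 1) * P)⁻¹ / 2 with hκ
  have hκ0 : 0 < κ := by positivity
  obtain ⟨M, hM⟩ := exists_pow_lt_of_lt_one (show 0 < κ / 2 by positivity)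
    (by norm_num : (1 / 2 : ℝ) < 1)
  rw [one_div, inv_pow] at hM
  set Cs : ℝ := ∑ j ∈ Finset.range (l + 1), sublevelConst j with hCs
  have hCsj : ∀ j ≤ l, sublevelConst j ≤ Cs := fun j hj =>
    Finset.single_le_sum (f := sublevelConst) (fun i _ => sublevelConst_nonneg i)
      (Finset.mem_range.2 (Nat.lt_succ_of_le hj))
  have hCs0 : 0 ≤ Cs := Finset.sum_nonneg fun i _ => sublevelConst_nonneg i
  refine ⟨min 1 (κ / (2 * (l + 1))), κ, 1 + 2 ^ M * (3 ^ d * Cs), by positivity, min_le_left _ _,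
    hκ0, by positivity, ?_⟩
  intro g N x hg hpos hosc y₀ hy₀ ε hε
  set r : ℝ := (2 ^ N)⁻¹ with hr
  have hr0 : 0 < r := by positivity
  set τ : ℝ := min 1 (κ / (2 * (l + 1))) with hτ
  set T : ℝ := jetSize l r g y₀ with hT
  have hT0 : 0 < T := hpos y₀ hy₀
  have hκT : 0 < κ * T := by positivity
  set t : ℝ := ε / (κ * T) with ht
  have ht0 : 0 < t := div_pos hε hκT
  have hbound : ∀ y ∈ dyadicCube N x, ∀ z ∈ dyadicCube N x, ∀ i ≤ l,
      r ^ i * ‖iteratedFDeriv ℝ i g z‖ ≤ 2 * jetSize l r g y := fun y hy z hz i hi =>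
    scaled_norm_iteratedFDeriv_le hg (hosc y hy) (min_le_left _ _) hy hz hi
  have hcomp : ∀ y ∈ dyadicCube N x, ∀ z ∈ dyadicCube N x,
      jetSize l r g z ≤ 2 * (l + 1) * jetSize l r g y := by
    intro y hy z hz
    have := Finset.sum_le_card_nsmul (Finset.range (l + 1))
      (fun i => r ^ i * ‖iteratedFDeriv ℝ i g z‖) (2 * jetSize l r g y)
      fun i hi => hbound y hy z hz i (Nat.lt_succ_iff.1 (Finset.mem_range.1 hi))
    rw [Finset.card_range, nsmul_eq_mul] at this
    push_cast at this
    unfold jetSize at this ⊢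
    linarith
  rcases le_or_gt 1 t with ht1 | ht1
  · -- the estimate is trivial for large `ε`
    refine (measure_mono Set.inter_subset_right).trans (le_mul_of_one_le_left zero_le ?_)
    rw [← ENNReal.ofReal_one]
    refine ENNReal.ofReal_le_ofReal ?_
    have h1 : 1 ≤ t ^ (1 / (l : ℝ)) := Real.one_le_rpow ht1 (by positivity)
    have h2 : 0 ≤ (2 : ℝ) ^ M * (3 ^ d * Cs) := by positivity
    nlinarith
  refine measure_inter_dyadicCube_le x N fun z _ hz => ⟨N + M, Nat.le_add_right _ _, ?_⟩
  have hsub : dyadicCube (N + M) z ⊆ dyadicCube N x := by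
    rw [← dyadicCube_eq_of_mem hz]
    exact dyadicCube_subset_of_le (Nat.le_add_right _ _)
  obtain ⟨j, hjl, v, hv, hvT⟩ := exists_diag_iteratedFDeriv_ge hr0 (hg z hz)
  have hz2 : 2 * (κ * T) ≤ r ^ j * |iteratedFDeriv ℝ j g z fun _ => v| := by
    have h1 := hcomp z hz y₀ hy₀
    have h2 : T ≤ 2 * (l + 1) * (P * (r ^ j * |iteratedFDeriv ℝ j g z fun _ => v|)) :=
      h1.trans (by gcongr)
    rw [hκ]
    have h3 : 0 < 2 * ((l : ℝ) + 1) * P := by positivity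
    rw [show 2 * ((2 * ((l : ℝ) + 1) * P)⁻¹ / 2 * T) = T / (2 * (l + 1) * P) by field_simp,
      div_le_iff₀ h3]
    linarith
  have hvar : ∀ w ∈ dyadicCube (N + M) z,
      r ^ j * ‖iteratedFDeriv ℝ j g w - iteratedFDeriv ℝ j g z‖ ≤ κ * T := by
    intro w hw
    rcases hjl.lt_or_eq with hlt | rfl
    · have h1 : ∀ y ∈ dyadicCube (N + M) z,
          ‖iteratedFDeriv ℝ (j + 1) g y‖ ≤ 2 * T / r ^ (j + 1) := by
        intro y hy
        rw [le_div_iff₀ (by positivity), mul_comm]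
        exact hbound y₀ hy₀ y (hsub hy) (j + 1) hlt
      have h2 := norm_iteratedFDeriv_sub_le hlt (fun y hy => hg y (hsub hy)) h1 hw
        mem_dyadicCube_self
      have h3 : ((2 : ℝ) ^ (N + M))⁻¹ = r * (2 ^ M)⁻¹ := by rw [hr, pow_add, mul_inv]
      calc r ^ j * ‖iteratedFDeriv ℝ j g w - iteratedFDeriv ℝ j g z‖
          ≤ r ^ j * (2 * T / r ^ (j + 1) * (r * (2 ^ M)⁻¹)) := by
            rw [← h3]; gcongr
        _ = 2 * T * (2 ^ M)⁻¹ := by rw [pow_succ]; field_simp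
        _ ≤ 2 * T * (κ / 2) := by gcongr
        _ = κ * T := by ring
    · have h1 := hosc z hz w (hsub hw)
      have h2 := hcomp y₀ hy₀ z hz
      have h3 : τ ≤ κ / (2 * (j + 1)) := min_le_right _ _
      have h4 : 0 ≤ jetSize j r g z := (hpos z hz).le
      calc r ^ j * ‖iteratedFDeriv ℝ j g w - iteratedFDeriv ℝ j g z‖
          ≤ κ / (2 * (j + 1)) * (2 * (j + 1) * T) := h1.trans (by gcongr)
        _ = κ * T := by field_simp
  have hdiff : ∀ w ∈ dyadicCube (N + M) z, r ^ j *
      |(iteratedFDeriv ℝ j g w fun _ => v) - iteratedFDeriv ℝ j g z fun _ => v| ≤ κ * T := by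
    intro w hw
    refine le_trans ?_ (hvar w hw)
    gcongr
    have := (iteratedFDeriv ℝ j g w - iteratedFDeriv ℝ j g z).le_opNorm fun _ => v
    rw [Finset.prod_const, sub_apply, Real.norm_eq_abs] at this
    exact this.trans (mul_le_of_le_one_right (norm_nonneg _) (pow_le_one₀ (norm_nonneg _) hv))
  have hrj : 0 < r ^ j := by positivity
  -- hence this pure derivative has a constant sign and is bounded below on the small cube
  have hge : (∀ w ∈ dyadicCube (N + M) z, κ * T / r ^ j ≤ iteratedFDeriv ℝ j g w fun _ => v) ∨
      ∀ w ∈ dyadicCube (N + M) z, κ * T / r ^ j ≤ -iteratedFDeriv ℝ j g w fun _ => v := by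
    rcases le_total 0 (iteratedFDeriv ℝ j g z fun _ => v) with hs | hs
    · refine Or.inl fun w hw => ?_
      rw [abs_of_nonneg hs] at hz2
      have h1 := hdiff w hw
      rw [← abs_of_pos hrj, ← abs_mul] at h1
      have h2 := (abs_le.1 h1).1
      rw [div_le_iff₀ hrj]
      nlinarith
    · refine Or.inr fun w hw => ?_
      rw [abs_of_nonpos hs] at hz2
      have h1 := hdiff w hw
      rw [← abs_of_pos hrj, ← abs_mul] at h1
      have h2 := (abs_le.1 h1).2
      rw [div_le_iff₀ hrj]
      nlinarith
  rcases Nat.eq_zero_or_pos j with rfl | hj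
  · -- order zero: the small cube does not meet the sublevel set
    have : {y | |g y| < ε} ∩ dyadicCube (N + M) z = ∅ := by
      rw [Set.eq_empty_iff_forall_notMem]
      rintro w ⟨hw, hwz⟩
      have h1 : ε < κ * T := by rwa [ht, div_lt_one hκT] at ht1
      simp only [pow_zero, div_one, iteratedFDeriv_zero_apply] at hge
      have h2 : κ * T ≤ |g w| := by
        rcases hge with h | h
        · exact (h w hwz).trans (le_abs_self _)
        · exact (h w hwz).trans (neg_le_abs _)
      exact absurd (h1.trans_le h2) (not_lt.2 (le_of_lt hw))
    rw [this, measure_empty]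
    exact zero_le
  have hj0 : (0 : ℝ) < j := by exact_mod_cast hj
  have hmain := volume_sublevel_inter_cube_le (A := κ * T / r ^ j) (N := N + M) (x := z)
    (g := g) hj hv (by positivity) hε
    (fun y hy => (hg y (hsub hy)).of_le (by exact_mod_cast hjl)) hge
  have hroot : (ε / (κ * T / r ^ j)) ^ (1 / (j : ℝ)) ≤ r * t ^ (1 / (l : ℝ)) := by
    have h1 : ε / (κ * T / r ^ j) = r ^ j * t := by rw [ht]; field_simp
    rw [h1, Real.mul_rpow hrj.le ht0.le, one_div, Real.pow_rpow_inv_natCast hr0.le hj.ne']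
    gcongr r * ?_
    refine Real.rpow_le_rpow_of_exponent_ge ht0 ht1.le ?_
    rw [one_div]
    gcongr
  have hside : ENNReal.ofReal ((2 ^ (N + M))⁻¹) ≠ 0 := by simp
  have hcancel : ENNReal.ofReal ((2 ^ (N + M))⁻¹) *
      volume ({y | |g y| < ε} ∩ dyadicCube (N + M) z) ≤ ENNReal.ofReal ((2 ^ (N + M))⁻¹) *
        (ENNReal.ofReal ((1 + 2 ^ M * (3 ^ d * Cs)) * t ^ (1 / (l : ℝ))) *
          volume (dyadicCube (N + M) z)) := by
    refine hmain.trans ?_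
    rw [← mul_assoc, ← mul_assoc, show (3 : ENNReal) ^ d = ENNReal.ofReal (3 ^ d) by
      rw [ENNReal.ofReal_pow (by norm_num)]; simp,
      ← ENNReal.ofReal_mul (mul_nonneg (sublevelConst_nonneg j)
      (Real.rpow_nonneg (by positivity) _)), ← ENNReal.ofReal_mul (by positivity)]
    gcongr ?_ * _
    refine ENNReal.ofReal_le_ofReal ?_
    have h3 : ((2 : ℝ) ^ (N + M))⁻¹ = r * (2 ^ M)⁻¹ := by rw [hr, pow_add, mul_inv]
    rw [h3]
    have h4 : 0 < t ^ (1 / (l : ℝ)) := Real.rpow_pos_of_pos ht0 _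
    calc sublevelConst j * (ε / (κ * T / r ^ j)) ^ (1 / (j : ℝ)) * 3 ^ d
        ≤ Cs * (r * t ^ (1 / (l : ℝ))) * 3 ^ d := by
          gcongr
          exact hCsj j hjl
      _ = r * (2 ^ M)⁻¹ * ((2 ^ M * (3 ^ d * Cs)) * t ^ (1 / (l : ℝ))) := by field_simp
      _ ≤ _ := by gcongr; linarith
  exact (ENNReal.mul_le_mul_iff_right hside ENNReal.ofReal_ne_top).1 hcancel

end Good

/-! ### Nondegenerate maps -/

section Nondegenerate

variable {d n : ℕ}

/-- The linear functional `y ↦ ∑ i, c i * y i`. -/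
noncomputable def linComb (c : Fin n → ℝ) : (Fin n → ℝ) →L[ℝ] ℝ :=
  ∑ i, c i • ContinuousLinearMap.proj i

lemma linComb_apply (c y : Fin n → ℝ) : linComb c y = ∑ i, c i * y i := by
  simp [linComb]

lemma norm_linComb_apply_le (c y : Fin n → ℝ) : ‖linComb c y‖ ≤ n * ‖c‖ * ‖y‖ := by
  rw [linComb_apply]
  calc ‖∑ i, c i * y i‖ ≤ ∑ i, ‖c i * y i‖ := norm_sum_le _ _
    _ ≤ ∑ _i : Fin n, ‖c‖ * ‖y‖ := by
        refine Finset.sum_le_sum fun i _ => ?_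
        rw [norm_mul]
        gcongr
        · exact norm_le_pi_norm c i
        · exact norm_le_pi_norm y i
    _ = n * ‖c‖ * ‖y‖ := by simp [mul_assoc]

lemma norm_linComb_comp_le {k : ℕ} (c : Fin n → ℝ) (A : (Fin d → ℝ) [×k]→L[ℝ] (Fin n → ℝ)) :
    ‖(linComb c).compContinuousMultilinearMap A‖ ≤ n * ‖c‖ * ‖A‖ := by
  refine ((linComb c).norm_compContinuousMultilinearMap_le A).trans ?_
  gcongr
  exact (linComb c).opNorm_le_bound (by positivity) (norm_linComb_apply_le c)

lemma iteratedFDeriv_const_add_linComb {k l : ℕ} (hk : 1 ≤ k) (hkl : k ≤ l)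
    {f : (Fin d → ℝ) → (Fin n → ℝ)} {y : Fin d → ℝ} (hf : ContDiffAt ℝ l f y) (c₀ : ℝ)
    (c : Fin n → ℝ) :
    iteratedFDeriv ℝ k (fun z => c₀ + linComb c (f z)) y =
      (linComb c).compContinuousMultilinearMap (iteratedFDeriv ℝ k f y) := by
  have hf' : ContDiffAt ℝ k f y := hf.of_le (by exact_mod_cast hkl)
  have h1 : ContDiffAt ℝ k (fun z => linComb c (f z)) y :=
    (linComb c).contDiff.contDiffAt.comp y hf'
  have h2 := iteratedFDeriv_add_apply (i := k) (f := fun _ : Fin d → ℝ => c₀)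
    (contDiffAt_const (n := k)) h1
  rw [iteratedFDeriv_const_of_ne (by omega), Pi.zero_apply, zero_add] at h2
  exact h2.trans ((linComb c).iteratedFDeriv_comp_left hf' le_rfl)

/-- At a nondegenerate point the derivatives of a nontrivial linear combination of the components
are bounded below in terms of the coefficients. -/
lemma IsNondegenerateOfOrder.exists_le_norm {l : ℕ} {f : (Fin d → ℝ) → (Fin n → ℝ)}
    {x : Fin d → ℝ} (h : IsNondegenerateOfOrder l f x) :
    ∃ κ : ℝ, 0 < κ ∧ ∀ c : Fin n → ℝ, c ≠ 0 → ∃ k, 1 ≤ k ∧ k ≤ l ∧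
      κ * ‖c‖ ≤ ‖(linComb c).compContinuousMultilinearMap (iteratedFDeriv ℝ k f x)‖ := by
  let Φ : (Fin n → ℝ) →ₗ[ℝ] ((k : Fin l) → (Fin d → ℝ) [×(k + 1 : ℕ)]→L[ℝ] ℝ) :=
    { toFun := fun c k =>
        (linComb c).compContinuousMultilinearMap (iteratedFDeriv ℝ (k + 1 : ℕ) f x)
      map_add' := fun c c' => by
        ext k v
        simp [linComb_apply, add_mul, Finset.sum_add_distrib]
      map_smul' := fun a c => by
        ext k v
        simp [linComb_apply, mul_assoc, Finset.mul_sum] }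
  have hinj : LinearMap.ker Φ = ⊥ := by
    rw [LinearMap.ker_eq_bot']
    intro c hc
    have hzero : (linComb c).toLinearMap = 0 := by
      refine LinearMap.ext_on (h : Submodule.span ℝ _ = ⊤) ?_
      rintro _ ⟨k, hk1, hkl, i, rfl⟩
      obtain ⟨k, rfl⟩ := Nat.exists_eq_add_of_le' hk1
      have h1 := congrFun hc ⟨k, hkl⟩
      exact congrArg (fun A => A fun j => Pi.single (i j) 1) h1
    ext i
    have := congrArg (fun L => L (Pi.single i 1)) hzero
    simpa [linComb_apply, Pi.single_apply] using this
  obtain ⟨K, hK, hΦ⟩ := Φ.exists_antilipschitzWith hinj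
  refine ⟨(K : ℝ)⁻¹, by positivity, fun c hc => ?_⟩
  have h1 : ‖c‖ ≤ K * ‖Φ c‖ := by
    have := hΦ.le_mul_dist c 0
    simpa using this
  by_contra! hlt
  have hc0 : 0 < (K : ℝ)⁻¹ * ‖c‖ := by positivity
  have h2 : ‖Φ c‖ < (K : ℝ)⁻¹ * ‖c‖ :=
    (pi_norm_lt_iff hc0).2 fun k => hlt (k + 1) (by omega) (by omega)
  have h3 : (K : ℝ) * ‖Φ c‖ < K * ((K : ℝ)⁻¹ * ‖c‖) := by gcongr
  rw [mul_inv_cancel_left₀ (by positivity)] at h3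
  linarith

/-- Near a nondegenerate point, all affine combinations of the components of `f` satisfy one
sublevel set estimate on dyadic cubes, and those with large coefficients are not uniformly small.
In other words they are `(C, α)`-good with uniform constants. -/
theorem IsNondegenerateOfOrder.exists_good {l : ℕ} (hl : 1 ≤ l) {f : (Fin d → ℝ) → (Fin n → ℝ)}
    {x₀ : Fin d → ℝ} (h : IsNondegenerateOfOrder l f x₀)
    (hf : ContDiffAt ℝ l f x₀) :
    ∃ (N₀ : ℕ) (C α ρ : ℝ), 0 < C ∧ 0 < α ∧ 0 < ρ ∧
      (∀ y ∈ dyadicCube N₀ x₀, ContDiffAt ℝ l f y) ∧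
      (∀ (c₀ : ℝ) (c : Fin n → ℝ) (N : ℕ) (x : Fin d → ℝ), N₀ ≤ N → x ∈ dyadicCube N₀ x₀ →
        ∀ t > 0, (∃ y ∈ dyadicCube N x, t ≤ |c₀ + linComb c (f y)|) → ∀ ε > 0,
        volume ({y | |c₀ + linComb c (f y)| < ε} ∩ dyadicCube N x) ≤
          ENNReal.ofReal (C * (ε / t) ^ α) * volume (dyadicCube N x)) ∧
      (∀ (c₀ : ℝ) (c : Fin n → ℝ), (1 ≤ ‖c‖ ∨ c = 0 ∧ 1 ≤ |c₀|) →
        ∃ y ∈ dyadicCube N₀ x₀, ρ ≤ |c₀ + linComb c (f y)|) := by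
  obtain ⟨κ₁, hκ₁, hlow⟩ := h.exists_le_norm
  obtain ⟨τ, κ, C, hτ, -, hκ, hC, hsub⟩ := exists_volume_sublevel_le d hl
  have hl0 : (0 : ℝ) < l := by exact_mod_cast hl
  -- the allowed oscillation of the derivatives of `f`
  obtain ⟨η, hη, hη1, hη2⟩ : ∃ η : ℝ, 0 < η ∧ n * η ≤ κ₁ / 2 ∧ n * (2 * η) ≤ τ * (κ₁ / 2) := by
    refine ⟨min (κ₁ / (2 * (n + 1))) (τ * κ₁ / (4 * (n + 1))), by positivity, ?_, ?_⟩
    · calc (n : ℝ) * min (κ₁ / (2 * (n + 1))) (τ * κ₁ / (4 * (n + 1)))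
          ≤ (n + 1) * (κ₁ / (2 * (n + 1))) :=
            mul_le_mul (by linarith) (min_le_left _ _) (by positivity) (by positivity)
        _ = κ₁ / 2 := by field_simp
    · calc (n : ℝ) * (2 * min (κ₁ / (2 * (n + 1))) (τ * κ₁ / (4 * (n + 1))))
          ≤ (n + 1) * (2 * (τ * κ₁ / (4 * (n + 1)))) :=
            mul_le_mul (by linarith) (by gcongr; exact min_le_right _ _) (by positivity)
              (by positivity)
        _ = τ * (κ₁ / 2) := by field_simp; norm_num
  have hnhds : ∀ᶠ y in nhds x₀, ContDiffAt ℝ l f y ∧ ∀ k ∈ Finset.range (l + 1),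
      ‖iteratedFDeriv ℝ k f y - iteratedFDeriv ℝ k f x₀‖ < η := by
    refine (hf.eventually (by simp)).and ((Filter.eventually_all_finset _).2 fun k hk => ?_)
    have hkl : k ≤ l := Nat.lt_succ_iff.1 (Finset.mem_range.1 hk)
    have hcont := hf.continuousAt_iteratedFDeriv (k := k) (by exact_mod_cast hkl)
    have := Metric.continuousAt_iff'.1 hcont η hη
    simpa only [dist_eq_norm] using this
  obtain ⟨N₀, -, hN₀⟩ := exists_dyadicCube_subset hnhds 0
  have hsmooth : ∀ y ∈ dyadicCube N₀ x₀, ContDiffAt ℝ l f y := fun y hy => (hN₀ hy).1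
  have hclose : ∀ y ∈ dyadicCube N₀ x₀, ∀ k ≤ l,
      ‖iteratedFDeriv ℝ k f y - iteratedFDeriv ℝ k f x₀‖ ≤ η := fun y hy k hk =>
    ((hN₀ hy).2 k (Finset.mem_range.2 (Nat.lt_succ_of_le hk))).le
  -- lower bound for the jet
  have hjet : ∀ (c₀ : ℝ) (c : Fin n → ℝ) (N : ℕ), ∀ y ∈ dyadicCube N₀ x₀,
      ((2 : ℝ) ^ N)⁻¹ ^ l * (κ₁ / 2 * ‖c‖) ≤
        jetSize l (2 ^ N)⁻¹ (fun z => c₀ + linComb c (f z)) y := by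
    intro c₀ c N y hy
    have hnn : ∀ i ∈ Finset.range (l + 1), 0 ≤ ((2 : ℝ) ^ N)⁻¹ ^ i *
        ‖iteratedFDeriv ℝ i (fun z => c₀ + linComb c (f z)) y‖ := fun i _ => by positivity
    by_cases hc : c = 0
    · rw [hc, norm_zero, mul_zero, mul_zero, ← hc]
      exact Finset.sum_nonneg hnn
    obtain ⟨k, hk1, hkl, hk⟩ := hlow c hc
    refine le_trans ?_ (Finset.single_le_sum hnn (Finset.mem_range.2 (Nat.lt_succ_of_le hkl)))
    rw [iteratedFDeriv_const_add_linComb hk1 hkl (hsmooth y hy)]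
    have h1 : κ₁ / 2 * ‖c‖ ≤
        ‖(linComb c).compContinuousMultilinearMap (iteratedFDeriv ℝ k f y)‖ := by
      have h2 := norm_linComb_comp_le c (iteratedFDeriv ℝ k f y - iteratedFDeriv ℝ k f x₀)
      have h3 : (linComb c).compContinuousMultilinearMap
            (iteratedFDeriv ℝ k f y - iteratedFDeriv ℝ k f x₀) =
          (linComb c).compContinuousMultilinearMap (iteratedFDeriv ℝ k f y) -
            (linComb c).compContinuousMultilinearMap (iteratedFDeriv ℝ k f x₀) := by
        ext v; simp
      rw [h3] at h2
      have h4 := norm_le_norm_add_norm_sub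
        ((linComb c).compContinuousMultilinearMap (iteratedFDeriv ℝ k f y))
        ((linComb c).compContinuousMultilinearMap (iteratedFDeriv ℝ k f x₀))
      have h5 : n * ‖c‖ * ‖iteratedFDeriv ℝ k f y - iteratedFDeriv ℝ k f x₀‖ ≤
          κ₁ / 2 * ‖c‖ := by
        calc _ ≤ n * ‖c‖ * η := by gcongr; exact hclose y hy k hkl
          _ = n * η * ‖c‖ := by ring
          _ ≤ _ := by gcongr
      linarith
    have h6 : ((2 : ℝ) ^ N)⁻¹ ^ l ≤ ((2 : ℝ) ^ N)⁻¹ ^ k :=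
      pow_le_pow_of_le_one (by positivity) (inv_le_one_of_one_le₀ (one_le_pow₀ one_le_two)) hkl
    gcongr
  have hjet0 : ∀ (c₀ : ℝ) (c : Fin n → ℝ) (N : ℕ), ∀ y,
      |c₀ + linComb c (f y)| ≤ jetSize l (2 ^ N)⁻¹ (fun z => c₀ + linComb c (f z)) y := by
    intro c₀ c N y
    have := Finset.single_le_sum (f := fun i => ((2 : ℝ) ^ N)⁻¹ ^ i *
      ‖iteratedFDeriv ℝ i (fun z => c₀ + linComb c (f z)) y‖) (fun i _ => by positivity)
      (Finset.mem_range.2 (Nat.succ_pos l))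
    simpa [jetSize, norm_iteratedFDeriv_zero] using this
  have hcd : ∀ (c₀ : ℝ) (c : Fin n → ℝ), ∀ y ∈ dyadicCube N₀ x₀,
      ContDiffAt ℝ l (fun z => c₀ + linComb c (f z)) y := fun c₀ c y hy =>
    contDiffAt_const.add ((linComb c).contDiff.contDiffAt.comp y (hsmooth y hy))
  have hosc : ∀ (c₀ : ℝ) (c : Fin n → ℝ) (N : ℕ), ∀ y ∈ dyadicCube N₀ x₀,
      ∀ z ∈ dyadicCube N₀ x₀, ((2 : ℝ) ^ N)⁻¹ ^ l *
        ‖iteratedFDeriv ℝ l (fun z => c₀ + linComb c (f z)) z -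
          iteratedFDeriv ℝ l (fun z => c₀ + linComb c (f z)) y‖ ≤
        τ * jetSize l (2 ^ N)⁻¹ (fun z => c₀ + linComb c (f z)) y := by
    intro c₀ c N y hy z hz
    rw [iteratedFDeriv_const_add_linComb hl le_rfl (hsmooth y hy),
      iteratedFDeriv_const_add_linComb hl le_rfl (hsmooth z hz)]
    have h3 : (linComb c).compContinuousMultilinearMap (iteratedFDeriv ℝ l f z) -
            (linComb c).compContinuousMultilinearMap (iteratedFDeriv ℝ l f y) =
        (linComb c).compContinuousMultilinearMap
            (iteratedFDeriv ℝ l f z - iteratedFDeriv ℝ l f y) := by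
      ext v; simp
    rw [h3]
    have h4 : ‖iteratedFDeriv ℝ l f z - iteratedFDeriv ℝ l f y‖ ≤ 2 * η := by
      have := norm_sub_le_norm_sub_add_norm_sub (iteratedFDeriv ℝ l f z)
        (iteratedFDeriv ℝ l f x₀) (iteratedFDeriv ℝ l f y)
      rw [norm_sub_rev (iteratedFDeriv ℝ l f x₀)] at this
      linarith [hclose y hy l le_rfl, hclose z hz l le_rfl]
    calc ((2 : ℝ) ^ N)⁻¹ ^ l * ‖(linComb c).compContinuousMultilinearMap
          (iteratedFDeriv ℝ l f z - iteratedFDeriv ℝ l f y)‖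
        ≤ ((2 : ℝ) ^ N)⁻¹ ^ l * (n * ‖c‖ * (2 * η)) := by
          gcongr
          exact (norm_linComb_comp_le _ _).trans (by gcongr)
      _ = ((2 : ℝ) ^ N)⁻¹ ^ l * (n * (2 * η) * ‖c‖) := by ring
      _ ≤ ((2 : ℝ) ^ N)⁻¹ ^ l * (τ * (κ₁ / 2) * ‖c‖) := by gcongr
      _ = τ * (((2 : ℝ) ^ N)⁻¹ ^ l * (κ₁ / 2 * ‖c‖)) := by ring
      _ ≤ _ := by gcongr; exact hjet c₀ c N y hy
  have hpos : ∀ (c₀ : ℝ) (c : Fin n → ℝ) (N : ℕ), (c ≠ 0 ∨ c₀ ≠ 0) → ∀ y ∈ dyadicCube N₀ x₀,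
      0 < jetSize l (2 ^ N)⁻¹ (fun z => c₀ + linComb c (f z)) y := by
    intro c₀ c N hne y hy
    by_cases hc : c = 0
    · have hc₀ : c₀ ≠ 0 := hne.resolve_left (not_not_intro hc)
      refine lt_of_lt_of_le ?_ (hjet0 c₀ c N y)
      have : linComb c (f y) = 0 := by rw [linComb_apply, hc]; simp
      rw [this, add_zero]
      exact abs_pos.2 hc₀
    · refine lt_of_lt_of_le ?_ (hjet c₀ c N y hy)
      positivity
  have hcube : ∀ {N x}, N₀ ≤ N → x ∈ dyadicCube N₀ x₀ → dyadicCube N x ⊆ dyadicCube N₀ x₀ := by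
    intro N x hN hx
    rw [← dyadicCube_eq_of_mem hx]
    exact dyadicCube_subset_of_le hN
  set t₀ : ℝ := min 1 (((2 : ℝ) ^ N₀)⁻¹ ^ l * (κ₁ / 2)) with ht₀
  have ht₀0 : 0 < t₀ := by positivity
  refine ⟨N₀, C * (2 / κ) ^ (1 / (l : ℝ)), 1 / l, κ * t₀ * (1 / (2 * C)) ^ l, by positivity,
    by positivity, by positivity, hsmooth, ?_, ?_⟩
  · rintro c₀ c N x hN hx t ht ⟨y, hy, hty⟩ ε hε
    have hne : c ≠ 0 ∨ c₀ ≠ 0 := by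
      by_contra! hz
      rw [hz.1, hz.2, linComb_apply] at hty
      simp at hty
      linarith
    have hQ := hcube hN hx
    have h1 := hsub (fun z => c₀ + linComb c (f z)) N x (fun w hw => hcd c₀ c w (hQ hw))
      (fun w hw => hpos c₀ c N hne w (hQ hw))
      (fun w hw z hz => hosc c₀ c N w (hQ hw) z (hQ hz)) y hy ε hε
    refine h1.trans ?_
    have h2 := hty.trans (hjet0 c₀ c N y)
    have h3 : 0 < jetSize l (2 ^ N)⁻¹ (fun z => c₀ + linComb c (f z)) y :=
      hpos c₀ c N hne y (hQ hy)
    gcongr ?_ * _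
    refine ENNReal.ofReal_le_ofReal ?_
    rw [mul_assoc, ← Real.mul_rpow (by positivity) (by positivity)]
    gcongr C * ?_ ^ _
    rw [div_mul_div_comm, div_le_div_iff₀ (by positivity) (by positivity)]
    have h4 : 0 < ε * κ := by positivity
    nlinarith
  · intro c₀ c hc
    by_contra! hlt
    have hne : c ≠ 0 ∨ c₀ ≠ 0 := by
      rcases hc with hc | ⟨-, hc⟩
      · left; rintro rfl; norm_num at hc
      · right; rintro rfl; norm_num at hc
    have hT : t₀ ≤ jetSize l (2 ^ N₀)⁻¹ (fun z => c₀ + linComb c (f z)) x₀ := by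
      rcases hc with hc | ⟨hc, hc'⟩
      · refine (min_le_right _ _).trans (le_trans ?_ (hjet c₀ c N₀ x₀ mem_dyadicCube_self))
        gcongr
        exact le_mul_of_one_le_right (by positivity) hc
      · refine (min_le_left _ _).trans (le_trans ?_ (hjet0 c₀ c N₀ x₀))
        rw [linComb_apply, hc]
        simpa using hc'
    have h1 := hsub (fun z => c₀ + linComb c (f z)) N₀ x₀ (hcd c₀ c) (hpos c₀ c N₀ hne)
      (hosc c₀ c N₀) x₀ mem_dyadicCube_self (κ * t₀ * (1 / (2 * C)) ^ l) (by positivity)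
    have hall : {y | |c₀ + linComb c (f y)| < κ * t₀ * (1 / (2 * C)) ^ l} ∩ dyadicCube N₀ x₀ =
        dyadicCube N₀ x₀ := Set.inter_eq_right.2 hlt
    rw [hall] at h1
    set T := jetSize l (2 ^ N₀)⁻¹ (fun z => c₀ + linComb c (f z)) x₀ with hTdef
    have hT0 : 0 < T := ht₀0.trans_le hT
    have h2 : C * (κ * t₀ * (1 / (2 * C)) ^ l / (κ * T)) ^ (1 / (l : ℝ)) ≤ 1 / 2 := by
      have h3 : κ * t₀ * (1 / (2 * C)) ^ l / (κ * T) ≤ (1 / (2 * C)) ^ l := by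
        rw [div_le_iff₀ (by positivity)]
        have : 0 < (1 / (2 * C)) ^ l * κ := by positivity
        nlinarith
      calc C * (κ * t₀ * (1 / (2 * C)) ^ l / (κ * T)) ^ (1 / (l : ℝ))
          ≤ C * ((1 / (2 * C)) ^ l) ^ (1 / (l : ℝ)) := by gcongr
        _ = C * (1 / (2 * C)) := by
            rw [one_div (l : ℝ), Real.pow_rpow_inv_natCast (by positivity) (by omega)]
        _ = 1 / 2 := by field_simp
    have h4 : volume (dyadicCube N₀ x₀) ≤ ENNReal.ofReal (1 / 2) * volume (dyadicCube N₀ x₀) :=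
      h1.trans (by gcongr)
    have h5 : ENNReal.ofReal (1 / 2) * volume (dyadicCube N₀ x₀) <
        1 * volume (dyadicCube N₀ x₀) := by
      rw [ENNReal.mul_lt_mul_iff_left volume_dyadicCube_ne_zero volume_dyadicCube_ne_top]
      rw [ENNReal.ofReal_lt_one]
      norm_num
    rw [one_mul] at h5
    exact absurd h4 (not_le.2 h5)

end Nondegenerate

/-! ### Minors and integer bases of rational subspaces -/

section Minors

/-- All minors of maximal size of the matrix with columns `w 0, …, w (j - 1)`; the rows are
selected by arbitrary maps `σ`. With the maximum norm, this plays the role of the vector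
`w 0 ∧ ⋯ ∧ w (j - 1)`. -/
def minors {R ι : Type*} [CommRing R] {j : ℕ} (w : Fin j → ι → R) (σ : Fin j → ι) : R :=
  (Matrix.of fun a b => w b (σ a)).det

variable {R S ι : Type*} [CommRing R] [CommRing S] {j : ℕ}

lemma map_minors (φ : R →+* S) (w : Fin j → ι → R) (σ : Fin j → ι) :
    φ (minors w σ) = minors (fun b i => φ (w b i)) σ := by
  rw [minors, RingHom.map_det]
  rfl

lemma minors_eq_zero_of_not_injective (w : Fin j → ι → R) {σ : Fin j → ι}
    (hσ : ¬ Function.Injective σ) : minors w σ = 0 := by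
  simp only [Function.Injective, not_forall] at hσ
  obtain ⟨a, a', h, hne⟩ := hσ
  refine Matrix.det_zero_of_row_eq hne ?_
  ext b
  simp [h]

/-- Change of basis multiplies all minors by the same determinant. -/
lemma minors_sum_smul (w : Fin j → ι → R) (T : Matrix (Fin j) (Fin j) R) (σ : Fin j → ι) :
    minors (fun b i => ∑ c, T b c * w c i) σ = T.det * minors w σ := by
  rw [minors, minors, ← Matrix.det_transpose T, mul_comm, ← Matrix.det_mul]
  congr 1
  ext a b
  simp [Matrix.mul_apply, mul_comm]

/-- A row that is a linear combination of the rows of the matrix. -/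
lemma det_update_sum_row [Fintype ι] (w : Fin j → ι → R) (σ : Fin j → ι) (a : Fin j) (B : ι → R) :
    (Matrix.of fun a' b => if a' = a then ∑ i, B i * w b i else w b (σ a')).det =
      ∑ i, B i * minors w (Function.update σ a i) := by
  classical
  have h := (Matrix.detRowAlternating (n := Fin j) (R := R)).toMultilinearMap.map_update_sum
    Finset.univ a (fun i : ι => B i • fun b => w b i) (fun a' b => w b (σ a'))
  have h1 : (Function.update (fun a' b => w b (σ a')) a (∑ i, B i • fun b => w b i) :
      Fin j → Fin j → R) = fun a' b => if a' = a then ∑ i, B i * w b i else w b (σ a') := by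
    ext a' b
    rcases eq_or_ne a' a with rfl | hne
    · simp [Finset.sum_apply]
    · simp [hne]
  rw [h1] at h
  refine h.trans (Finset.sum_congr rfl fun i _ => ?_)
  rw [MultilinearMap.map_update_smul, smul_eq_mul]
  congr 1
  change Matrix.det _ = Matrix.det _
  congr 1
  ext a' b
  rcases eq_or_ne a' a with rfl | hne
  · simp
  · simp [hne]

/-- Linearly independent vectors have a nonzero minor. -/
lemma exists_minors_ne_zero {K : Type*} [Field K] [Fintype ι] {w : Fin j → ι → K}
    (hw : LinearIndependent K w) : ∃ σ, minors w σ ≠ 0 := by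
  classical
  by_contra! h0
  let L : (Fin j → K) →ₗ[K] (ι → K) := Fintype.linearCombination K w
  have hL : LinearMap.ker L = ⊥ := LinearMap.ker_eq_bot.2
    hw.fintypeLinearCombination_injective
  obtain ⟨B, hB⟩ := L.exists_leftInverse_of_injective hL
  have hBw : ∀ b, B (w b) = Pi.single b 1 := by
    intro b
    have h1 : L (Pi.single b 1) = w b := by simp [L, Fintype.linearCombination_apply_single]
    rw [← h1]
    exact LinearMap.congr_fun hB _
  have h1 : ∀ a b, ∑ i, B (Pi.single i 1) a * w b i = if a = b then 1 else 0 := by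
    intro a b
    have h2 : B (w b) a = ∑ i, w b i * B (Pi.single i 1) a := by
      conv_lhs => rw [← Finset.univ_sum_single (w b), map_sum]
      rw [Finset.sum_apply]
      refine Finset.sum_congr rfl fun i _ => ?_
      have : Pi.single i (w b i) = w b i • (Pi.single i 1 : ι → K) := by
        ext k; simp [Pi.single_apply]
      rw [this, map_smul]
      rfl
    rw [hBw, Pi.single_apply] at h2
    rw [h2]
    exact Finset.sum_congr rfl fun i _ => mul_comm _ _
  have h3 := (Matrix.detRowAlternating (n := Fin j) (R := K)).toMultilinearMap.map_sum
    (fun (a : Fin j) (i : ι) => B (Pi.single i 1) a • fun b => w b i)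
  have h4 : (fun a : Fin j => ∑ i, B (Pi.single i 1) a • fun b => w b i) =
      (1 : Matrix (Fin j) (Fin j) K) := by
    ext a b
    rw [Finset.sum_apply, Matrix.one_apply, ← h1 a b]
    rfl
  rw [h4] at h3
  have h5 : (Matrix.detRowAlternating (n := Fin j) (R := K)).toMultilinearMap
      (1 : Matrix (Fin j) (Fin j) K) = 1 := Matrix.det_one
  rw [h5] at h3
  refine one_ne_zero (h3.trans (Finset.sum_eq_zero fun σ _ => ?_))
  rw [MultilinearMap.map_smul_univ]
  have : (Matrix.detRowAlternating (n := Fin j) (R := K)).toMultilinearMap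
      (fun a b => w b (σ a)) = minors w σ := rfl
  rw [this, h0, smul_zero]

/-- Laplace expansion bounds the minors of an extended family. -/
lemma norm_minors_cons_le [Fintype ι] (v : ι → ℝ) (w : Fin j → ι → ℝ) :
    ‖minors (Fin.cons v w : Fin (j + 1) → ι → ℝ)‖ ≤ (j + 1) * ‖v‖ * ‖minors w‖ := by
  refine (pi_norm_le_iff_of_nonneg (by positivity)).2 fun σ => ?_
  rw [minors, Matrix.det_succ_column_zero]
  calc _ ≤ ∑ a : Fin (j + 1), ‖v‖ * ‖minors w‖ := by
        refine (norm_sum_le _ _).trans (Finset.sum_le_sum fun a _ => ?_)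
        rw [norm_mul, norm_mul, norm_pow, norm_neg, norm_one, one_pow, one_mul]
        gcongr
        · exact norm_le_pi_norm v (σ a)
        · exact norm_le_pi_norm (minors w) (σ ∘ a.succAbove)
    _ = (j + 1) * ‖v‖ * ‖minors w‖ := by simp; ring

end Minors

section IntBasis

variable {k j : ℕ}

/-- The integer vectors `w` form a basis of the rational subspace `V`. -/
structure IsIntBasis (V : Submodule ℚ (Fin k → ℚ)) (w : Fin j → Fin k → ℤ) : Prop where
  linearIndependent : LinearIndependent ℚ fun b i => (w b i : ℚ)
  span_eq : Submodule.span ℚ (Set.range fun b i => (w b i : ℚ)) = V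

lemma IsIntBasis.eq_finrank {V : Submodule ℚ (Fin k → ℚ)} {w : Fin j → Fin k → ℤ}
    (h : IsIntBasis V w) : j = Module.finrank ℚ V := by
  rw [← h.span_eq, finrank_span_eq_card h.linearIndependent, Fintype.card_fin]

lemma exists_isIntBasis (V : Submodule ℚ (Fin k → ℚ)) :
    ∃ w : Fin (Module.finrank ℚ V) → Fin k → ℤ, IsIntBasis V w := by
  let e := Module.finBasis ℚ V
  have h1 : ∀ b, ∃ D : nonZeroDivisors ℤ,
      ∀ i, IsLocalization.IsInteger ℤ (D • (e b : Fin k → ℚ) i) :=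
    fun b => IsLocalization.exist_integer_multiples_of_finite (nonZeroDivisors ℤ) _
  choose D hD using h1
  choose w hw using hD
  have hD0 : ∀ b, ((D b : ℤ) : ℚ) ≠ 0 := fun b =>
    Int.cast_ne_zero.2 (nonZeroDivisors.ne_zero (D b).2)
  have hli : LinearIndependent ℚ fun b => (e b : Fin k → ℚ) :=
    e.linearIndependent.map' V.subtype (Submodule.ker_subtype V)
  have hw' : (fun b i => (w b i : ℚ)) =
      (fun b => Units.mk0 _ (hD0 b)) • fun b => (e b : Fin k → ℚ) := by
    ext b i
    have := hw b i
    simp only [algebraMap_int_eq, eq_intCast] at this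
    rw [this]
    simp [Submonoid.smul_def, Units.smul_def]
  have hli' : LinearIndependent ℚ fun b i => (w b i : ℚ) := by
    rw [hw']
    exact hli.units_smul _
  refine ⟨w, hli', ?_⟩
  refine Submodule.eq_of_le_of_finrank_eq (Submodule.span_le.2 ?_) ?_
  · rintro _ ⟨b, rfl⟩
    rw [hw']
    exact V.smul_mem _ (e b).2
  · rw [finrank_span_eq_card hli', Fintype.card_fin]

/-- Two integer bases of the same subspace are related by a rational matrix, so that their minors
after any linear map are proportional, with one factor for all maps. -/
lemma IsIntBasis.exists_minors_eq {V : Submodule ℚ (Fin k → ℚ)} {w w' : Fin j → Fin k → ℤ}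
    (h : IsIntBasis V w) (h' : IsIntBasis V w') :
    ∃ T : ℝ, ∀ A : (Fin k → ℝ) →ₗ[ℝ] (Fin k → ℝ),
      minors (fun b => A fun i => (w' b i : ℝ)) = T • minors (fun b => A fun i => (w b i : ℝ)) := by
  have h1 : ∀ b, ∃ c : Fin j → ℚ, ∑ a, c a • (fun i => (w a i : ℚ)) = fun i => (w' b i : ℚ) := by
    intro b
    refine (Submodule.mem_span_range_iff_exists_fun ℚ).1 ?_
    rw [h.span_eq, ← h'.span_eq]
    exact Submodule.subset_span ⟨b, rfl⟩
  choose T hT using h1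
  refine ⟨(Matrix.of fun b c => (T b c : ℝ)).det, fun A => ?_⟩
  ext σ
  rw [Pi.smul_apply, smul_eq_mul, ← minors_sum_smul]
  congr 1
  ext b i
  have h2 : (fun i => (w' b i : ℝ)) = ∑ a, (T b a : ℝ) • fun i => (w a i : ℝ) := by
    ext i
    have := congrFun (hT b) i
    simp only [Finset.sum_apply, Pi.smul_apply, smul_eq_mul] at this ⊢
    exact_mod_cast this.symm
  rw [h2, map_sum, Finset.sum_apply]
  simp

/-- Every rational subspace has an integer basis whose minors, after any linear map, are minimal
among all integer bases; a basis of the lattice of integer points of the subspace is one. -/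
lemma exists_minimal_isIntBasis (V : Submodule ℚ (Fin k → ℚ)) :
    ∃ w : Fin (Module.finrank ℚ V) → Fin k → ℤ, IsIntBasis V w ∧
      ∀ (j : ℕ) (w' : Fin j → Fin k → ℤ), IsIntBasis V w' →
        ∀ A : (Fin k → ℝ) →ₗ[ℝ] (Fin k → ℝ),
          ‖minors (fun b => A fun i => (w b i : ℝ))‖ ≤
            ‖minors (fun b => A fun i => (w' b i : ℝ))‖ := by
  classical
  let size : (Fin (Module.finrank ℚ V) → Fin k → ℤ) → ℕ := fun w => ∑ σ, (minors w σ).natAbs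
  have hex : ∃ s, ∃ w : Fin (Module.finrank ℚ V) → Fin k → ℤ, IsIntBasis V w ∧ size w = s := by
    obtain ⟨w, hw⟩ := exists_isIntBasis V
    exact ⟨_, w, hw, rfl⟩
  obtain ⟨w, hw, hsize⟩ := Nat.find_spec hex
  refine ⟨w, hw, fun j w' hw' A => ?_⟩
  obtain rfl := hw'.eq_finrank
  obtain ⟨T, hT⟩ := hw.exists_minors_eq hw'
  have hle : size w ≤ size w' := by
    rw [hsize]
    exact Nat.find_min' hex ⟨w', hw', rfl⟩
  have hpos : 0 < size w := by
    obtain ⟨σ, hσ⟩ := exists_minors_ne_zero hw.linearIndependent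
    refine Finset.sum_pos' (fun _ _ => Nat.zero_le _) ⟨σ, Finset.mem_univ _, ?_⟩
    rw [Int.natAbs_pos]
    intro h0
    refine hσ ?_
    have := map_minors (Int.castRingHom ℚ) w σ
    rw [h0, map_zero] at this
    exact this.symm
  have hcast : ∀ w : Fin (Module.finrank ℚ V) → Fin k → ℤ,
      (size w : ℝ) = ∑ σ, |minors (fun b i => (w b i : ℝ)) σ| := by
    intro w
    simp only [size, Nat.cast_sum, Nat.cast_natAbs]
    refine Finset.sum_congr rfl fun σ _ => ?_
    have := map_minors (Int.castRingHom ℝ) w σ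
    simp only [eq_intCast] at this
    rw [← this, Int.cast_abs]
  have hT1 : 1 ≤ |T| := by
    have h1 : (size w' : ℝ) = |T| * size w := by
      rw [hcast, hcast, Finset.mul_sum]
      refine Finset.sum_congr rfl fun σ _ => ?_
      have := congrFun (hT LinearMap.id) σ
      simp only [LinearMap.id_apply] at this
      rw [this, Pi.smul_apply, smul_eq_mul, abs_mul]
    have h2 : (size w : ℝ) ≤ size w' := by exact_mod_cast hle
    have h3 : (0 : ℝ) < size w := by exact_mod_cast hpos
    rw [h1] at h2
    exact (le_mul_iff_one_le_left h3).1 h2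
  rw [hT A, norm_smul, Real.norm_eq_abs]
  exact le_mul_of_one_le_left (norm_nonneg _) hT1

/-- An integer basis with minimal minors. -/
noncomputable def minBasis (V : Submodule ℚ (Fin k → ℚ)) :
    Fin (Module.finrank ℚ V) → Fin k → ℤ :=
  (exists_minimal_isIntBasis V).choose

lemma isIntBasis_minBasis (V : Submodule ℚ (Fin k → ℚ)) : IsIntBasis V (minBasis V) :=
  (exists_minimal_isIntBasis V).choose_spec.1

lemma norm_minors_minBasis_le {V : Submodule ℚ (Fin k → ℚ)} {w : Fin j → Fin k → ℤ}
    (h : IsIntBasis V w) (A : (Fin k → ℝ) →ₗ[ℝ] (Fin k → ℝ)) :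
    ‖minors (fun b => A fun i => (minBasis V b i : ℝ))‖ ≤
      ‖minors (fun b => A fun i => (w b i : ℝ))‖ :=
  (exists_minimal_isIntBasis V).choose_spec.2 j w h A

lemma IsIntBasis.cons {V : Submodule ℚ (Fin k → ℚ)} {w : Fin j → Fin k → ℤ} (h : IsIntBasis V w)
    {v : Fin k → ℤ} (hv : (fun i => (v i : ℚ)) ∉ V) :
    IsIntBasis (V ⊔ Submodule.span ℚ {fun i => (v i : ℚ)})
      (Fin.cons v w : Fin (j + 1) → Fin k → ℤ) := by
  have h1 : (fun b i => ((Fin.cons v w : Fin (j + 1) → Fin k → ℤ) b i : ℚ)) =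
      Fin.cons (fun i => (v i : ℚ)) fun b i => (w b i : ℚ) := by
    ext b i
    induction b using Fin.cases <;> simp
  refine ⟨?_, ?_⟩
  · rw [h1, linearIndependent_finCons, h.span_eq]
    exact ⟨h.linearIndependent, hv⟩
  · rw [h1, Fin.range_cons, Submodule.span_insert, h.span_eq, sup_comm]

end IntBasis

/-! ### Lattices along the flow -/

section Flow

variable {d n : ℕ}

/-- The diagonal entries of `g_t = diag(2^(t₁ + ⋯ + tₙ), 2^(-t₁), …, 2^(-tₙ))`. -/
noncomputable def flowScale (t : Fin n → ℕ) : Fin (n + 1) → ℝ :=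
  Fin.cons (2 ^ ∑ i, t i) fun i => (2 ^ t i)⁻¹

/-- The linear map `g_t u_y`, where `u_y (p, q) = (p + q · y, q)` and `g_t` is the diagonal map
with entries `flowScale t`. -/
noncomputable def flowMap (t : Fin n → ℕ) (y : Fin n → ℝ) :
    (Fin (n + 1) → ℝ) →ₗ[ℝ] (Fin (n + 1) → ℝ) where
  toFun v k := flowScale t k *
    (Fin.cons (v 0 + ∑ i, y i * v i.succ) fun i => v i.succ : Fin (n + 1) → ℝ) k
  map_add' v w := by
    ext k
    induction k using Fin.cases with
    | zero => simp only [Fin.cons_zero, Pi.add_apply, mul_add, Finset.sum_add_distrib]; ring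
    | succ i => simp [mul_add]
  map_smul' a v := by
    ext k
    induction k using Fin.cases with
    | zero =>
      simp only [Fin.cons_zero, Pi.smul_apply, smul_eq_mul, RingHom.id_apply]
      simp_rw [mul_left_comm _ a, ← Finset.mul_sum]
      ring
    | succ i => simp [mul_left_comm]

lemma flowMap_apply_zero (t : Fin n → ℕ) (y : Fin n → ℝ) (v : Fin (n + 1) → ℝ) :
    flowMap t y v 0 = 2 ^ (∑ i, t i) * (v 0 + ∑ i, y i * v i.succ) := rfl

lemma flowMap_apply_succ (t : Fin n → ℕ) (y : Fin n → ℝ) (v : Fin (n + 1) → ℝ) (i : Fin n) :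
    flowMap t y v i.succ = (2 ^ t i)⁻¹ * v i.succ := rfl

lemma flowScale_pos (t : Fin n → ℕ) (k : Fin (n + 1)) : 0 < flowScale t k := by
  induction k using Fin.cases <;> simp [flowScale]

lemma prod_flowScale (t : Fin n → ℕ) : ∏ k, flowScale t k = 1 := by
  rw [Fin.prod_univ_succ]
  simp only [flowScale, Fin.cons_zero, Fin.cons_succ, Finset.prod_inv_distrib,
    Finset.prod_pow_eq_pow_sum]
  exact mul_inv_cancel₀ (by positivity)

lemma flowScale_succ_le_one (t : Fin n → ℕ) (i : Fin n) : flowScale t i.succ ≤ 1 := by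
  simp only [flowScale, Fin.cons_succ]
  exact inv_le_one_of_one_le₀ (one_le_pow₀ one_le_two)

/-- The entries of `g_t` other than the first are at most `1` and the product of all entries is
`1`, so products that include the first entry are at least `1`. -/
lemma one_le_prod_flowScale {j : ℕ} (t : Fin n → ℕ) {σ : Fin j → Fin (n + 1)}
    (hσ : Function.Injective σ) {a : Fin j} (ha : σ a = 0) : 1 ≤ ∏ b, flowScale t (σ b) := by
  classical
  rw [← Finset.prod_image (f := flowScale t) (g := σ) (s := Finset.univ) hσ.injOn]
  have h1 := Finset.prod_mul_prod_compl (Finset.univ.image σ) (flowScale t)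
  rw [prod_flowScale] at h1
  have h2 : ∏ k ∈ (Finset.univ.image σ)ᶜ, flowScale t k ≤ 1 := by
    refine Finset.prod_le_one (fun k _ => (flowScale_pos t k).le) fun k hk => ?_
    have hk0 : k ≠ 0 := by
      rintro rfl
      exact (Finset.mem_compl.1 hk) (Finset.mem_image.2 ⟨a, Finset.mem_univ _, ha⟩)
    obtain ⟨i, rfl⟩ := Fin.exists_succ_eq.2 hk0
    exact flowScale_succ_le_one t i
  have h3 : 0 < ∏ k ∈ Finset.univ.image σ, flowScale t k :=
    Finset.prod_pos fun k _ => flowScale_pos t k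
  nlinarith

lemma minors_flowMap_of_ne_zero {j : ℕ} (t : Fin n → ℕ) (y : Fin n → ℝ)
    (w : Fin j → Fin (n + 1) → ℝ) {σ : Fin j → Fin (n + 1)} (hσ : ∀ a, σ a ≠ 0) :
    minors (fun b => flowMap t y (w b)) σ = (∏ a, flowScale t (σ a)) * minors w σ := by
  rw [minors, minors, ← Matrix.det_mul_column]
  congr 1
  ext a b
  obtain ⟨i, hi⟩ := Fin.exists_succ_eq.2 (hσ a)
  simp only [Matrix.of_apply]
  rw [← hi, flowMap_apply_succ]
  rfl

lemma minors_flowMap_of_eq_zero {j : ℕ} (t : Fin n → ℕ) (y : Fin n → ℝ)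
    (w : Fin j → Fin (n + 1) → ℝ) {σ : Fin j → Fin (n + 1)} (hσ : Function.Injective σ)
    {a : Fin j} (ha : σ a = 0) :
    minors (fun b => flowMap t y (w b)) σ = (∏ a, flowScale t (σ a)) *
      (minors w σ + linComb (fun i : Fin n => minors w (Function.update σ a i.succ)) y) := by
  have h1 := det_update_sum_row w σ a (Fin.cons 1 y)
  rw [Fin.sum_univ_succ] at h1
  simp only [Fin.cons_zero, Fin.cons_succ, one_mul] at h1
  rw [show Function.update σ a 0 = σ by rw [← ha, Function.update_eq_self]] at h1
  rw [linComb_apply, Finset.sum_congr rfl fun i _ => mul_comm _ (y i), ← h1, minors,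
    ← Matrix.det_mul_column]
  congr 1
  ext a' b
  simp only [Matrix.of_apply]
  rcases eq_or_ne a' a with rfl | hne
  · rw [if_pos rfl, ha, Fin.sum_univ_succ]
    simp only [Fin.cons_zero, Fin.cons_succ, one_mul]
    rfl
  · have h0 : σ a' ≠ 0 := fun h => hne (hσ (h.trans ha.symm))
    obtain ⟨i, hi⟩ := Fin.exists_succ_eq.2 h0
    rw [if_neg hne, ← hi, flowMap_apply_succ]
    rfl

/-- The minors of `g_t u_y w` are affine functions of `y`. -/
lemma exists_minors_flowMap_eq {j : ℕ} (t : Fin n → ℕ) (w : Fin j → Fin (n + 1) → ℝ)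
    (σ : Fin j → Fin (n + 1)) : ∃ (c₀ : ℝ) (c : Fin n → ℝ), ∀ y,
      minors (fun b => flowMap t y (w b)) σ = c₀ + linComb c y := by
  by_cases hσ : Function.Injective σ
  · by_cases h0 : ∃ a, σ a = 0
    · obtain ⟨a, ha⟩ := h0
      refine ⟨(∏ a, flowScale t (σ a)) * minors w σ, fun i => (∏ a, flowScale t (σ a)) *
        minors w (Function.update σ a i.succ), fun y => ?_⟩
      rw [minors_flowMap_of_eq_zero t y w hσ ha, mul_add, linComb_apply, linComb_apply,
        Finset.mul_sum]
      simp only [mul_assoc]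
    · push Not at h0
      refine ⟨(∏ a, flowScale t (σ a)) * minors w σ, 0, fun y => ?_⟩
      rw [minors_flowMap_of_ne_zero t y w h0, linComb_apply]
      simp
  · refine ⟨0, 0, fun y => ?_⟩
    rw [minors_eq_zero_of_not_injective _ hσ, linComb_apply]
    simp

/-- For linearly independent integer vectors `w`, some minor of `g_t u_y w` dominates an affine
function of `y` with integer coefficients which are not all zero. -/
lemma exists_le_minors_flowMap {j : ℕ} (t : Fin n → ℕ) {w : Fin j → Fin (n + 1) → ℤ}
    (hw : LinearIndependent ℚ fun b i => (w b i : ℚ)) :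
    ∃ (σ : Fin j → Fin (n + 1)) (c₀ : ℝ) (c : Fin n → ℝ), (1 ≤ ‖c‖ ∨ c = 0 ∧ 1 ≤ |c₀|) ∧
      ∀ y, |c₀ + linComb c y| ≤
        |minors (fun b => flowMap t y fun i => (w b i : ℝ)) σ| := by
  obtain ⟨σ, hσ⟩ := exists_minors_ne_zero hw
  have hinj : Function.Injective σ := by
    by_contra h
    exact hσ (minors_eq_zero_of_not_injective _ h)
  have hcast : ∀ σ, minors (fun b i => (w b i : ℝ)) σ = (minors w σ : ℤ) := fun σ =>
    (map_minors (Int.castRingHom ℝ) w σ).symm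
  have hne : minors w σ ≠ 0 := by
    intro h0
    have := map_minors (Int.castRingHom ℚ) w σ
    rw [h0, map_zero] at this
    exact hσ this.symm
  have hone : ∀ σ, minors w σ ≠ 0 → 1 ≤ |minors (fun b i => (w b i : ℝ)) σ| := by
    intro σ h
    rw [hcast]
    exact_mod_cast Int.one_le_abs h
  rcases Nat.eq_zero_or_pos j with rfl | hj
  · refine ⟨σ, 1, 0, Or.inr ⟨rfl, by simp⟩, fun y => ?_⟩
    rw [minors, Matrix.det_isEmpty, linComb_apply]
    simp
  -- replace a row by the zeroth one, unless that row is used already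
  obtain ⟨σ', a, hinj', ha, hupd⟩ : ∃ (σ' : Fin j → Fin (n + 1)) (a : Fin j),
      Function.Injective σ' ∧ σ' a = 0 ∧ ∃ k, Function.update σ' a k = σ := by
    by_cases h0 : ∃ a, σ a = 0
    · obtain ⟨a, ha⟩ := h0
      exact ⟨σ, a, hinj, ha, σ a, Function.update_eq_self _ _⟩
    · push Not at h0
      refine ⟨Function.update σ ⟨0, hj⟩ 0, ⟨0, hj⟩, ?_, Function.update_self _ _ _, σ ⟨0, hj⟩, ?_⟩
      · intro b b' hbb
        by_cases h1 : b = ⟨0, hj⟩ <;> by_cases h2 : b' = ⟨0, hj⟩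
        · rw [h1, h2]
        · rw [h1, Function.update_self, Function.update_of_ne h2] at hbb
          exact absurd hbb.symm (h0 b')
        · rw [h2, Function.update_self, Function.update_of_ne h1] at hbb
          exact absurd hbb (h0 b)
        · rw [Function.update_of_ne h1, Function.update_of_ne h2] at hbb
          exact hinj hbb
      · rw [Function.update_idem, Function.update_eq_self]
  obtain ⟨k, hk⟩ := hupd
  refine ⟨σ', minors (fun b i => (w b i : ℝ)) σ',
    fun i => minors (fun b i => (w b i : ℝ)) (Function.update σ' a i.succ), ?_, fun y => ?_⟩
  · by_cases hex : ∃ i : Fin n, minors w (Function.update σ' a i.succ) ≠ 0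
    · obtain ⟨i, hi⟩ := hex
      exact Or.inl ((hone _ hi).trans (norm_le_pi_norm (fun i : Fin n =>
        minors (fun b i => (w b i : ℝ)) (Function.update σ' a i.succ)) i))
    · push Not at hex
      refine Or.inr ⟨?_, hone _ ?_⟩
      · ext i
        rw [hcast, hex]
        simp
      · induction k using Fin.cases with
        | zero =>
          rw [← ha, Function.update_eq_self] at hk
          rwa [hk]
        | succ i => exact absurd (hex i) (by rwa [hk])
  · rw [minors_flowMap_of_eq_zero t y _ hinj' ha, abs_mul]
    refine le_mul_of_one_le_left (abs_nonneg _) ?_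
    exact (one_le_prod_flowScale t hinj' ha).trans (le_abs_self _)

/-- The size of the subspace `V` under `g_t u_y`: the largest minor of the image of a minimal
integer basis. It stands for the covolume of the image of the lattice of integer points of `V`. -/
noncomputable def subspaceSize (t : Fin n → ℕ) (V : Submodule ℚ (Fin (n + 1) → ℚ))
    (y : Fin n → ℝ) : ℝ :=
  ‖minors fun b => flowMap t y fun i => (minBasis V b i : ℝ)‖

lemma subspaceSize_bot (t : Fin n → ℕ) (y : Fin n → ℝ) : subspaceSize t ⊥ y ≤ 1 := by
  refine (pi_norm_le_iff_of_nonneg zero_le_one).2 fun σ => ?_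
  have : IsEmpty (Fin (Module.finrank ℚ (⊥ : Submodule ℚ (Fin (n + 1) → ℚ)))) := by
    rw [finrank_bot]; infer_instance
  rw [minors, Matrix.det_isEmpty, norm_one]

lemma subspaceSize_sup_span_le (t : Fin n → ℕ) (V : Submodule ℚ (Fin (n + 1) → ℚ))
    (y : Fin n → ℝ) {v : Fin (n + 1) → ℤ} (hv : (fun i => (v i : ℚ)) ∉ V) :
    subspaceSize t (V ⊔ Submodule.span ℚ {fun i => (v i : ℚ)}) y ≤
      (n + 1) * ‖flowMap t y fun i => (v i : ℝ)‖ * subspaceSize t V y := by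
  have hbasis := (isIntBasis_minBasis V).cons hv
  refine (norm_minors_minBasis_le hbasis (flowMap t y)).trans ?_
  have h1 : (fun b => flowMap t y fun i =>
      ((Fin.cons v (minBasis V) : Fin (Module.finrank ℚ V + 1) → Fin (n + 1) → ℤ) b i : ℝ)) =
      Fin.cons (flowMap t y fun i => (v i : ℝ))
        fun b => flowMap t y fun i => (minBasis V b i : ℝ) := by
    ext b i
    induction b using Fin.cases <;> simp
  rw [h1]
  refine (norm_minors_cons_le _ _).trans ?_
  have h2 : Module.finrank ℚ V + 1 ≤ n + 1 := by
    rw [hbasis.eq_finrank]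
    exact (Submodule.finrank_le _).trans_eq (by simp)
  have h3 : (Module.finrank ℚ V + 1 : ℝ) ≤ n + 1 := by exact_mod_cast h2
  unfold subspaceSize
  gcongr

/-- At a protected point the lattice `g_t u_y ℤ^(n+1)` has no short nonzero vector. For an integer
vector `v`, let `V` be the largest subspace of the protecting flag that does not contain `v`. The
subspace spanned by `V` and `v` is comparable with the flag, so its size is at least `ε`; the size of
`V` is at most `1`. -/
lemma le_norm_flowMap_of_isProtecting {X : Type*} {f : X → Fin n → ℝ} {t : Fin n → ℕ} {ε ρ : ℝ}
    (hερ : ε ≤ ρ) (hρ : ρ ≤ 1) {F : Finset (Submodule ℚ (Fin (n + 1) → ℚ))} {x : X}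
    (hF : IsProtecting (fun V x => subspaceSize t V (f x)) ε ρ ∅ F x)
    {v : Fin (n + 1) → ℤ} (hv : v ≠ 0) :
    ε ≤ (n + 1) * ‖flowMap t (f x) fun i => (v i : ℝ)‖ := by
  classical
  set v' : Fin (n + 1) → ℚ := fun i => (v i : ℚ) with hv'
  have hv0 : v' ≠ 0 := by
    intro h
    refine hv (funext fun i => ?_)
    have h1 : (v i : ℚ) = 0 := congrFun h i
    exact_mod_cast h1
  obtain ⟨V, hVv, hV1, hVmax⟩ : ∃ V : Submodule ℚ (Fin (n + 1) → ℚ), v' ∉ V ∧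
      subspaceSize t V (f x) ≤ 1 ∧ ∀ U ∈ F, U ≤ V ∨ (V ≤ U ∧ v' ∈ U) := by
    rcases (F.filter fun U => v' ∉ U).eq_empty_or_nonempty with hempty | hne
    · refine ⟨⊥, by simpa using hv0, subspaceSize_bot _ _, fun U hU => Or.inr ⟨bot_le, ?_⟩⟩
      by_contra h
      have : U ∈ F.filter fun U => v' ∉ U := Finset.mem_filter.2 ⟨hU, h⟩
      rw [hempty] at this
      exact absurd this (Finset.notMem_empty _)
    · obtain ⟨V, hV⟩ := Finset.exists_maximal hne
      have hVF := Finset.mem_filter.1 hV.1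
      refine ⟨V, hVF.2, ((hF.mem_Icc V hVF.1 (Finset.notMem_empty _)).2).trans hρ, fun U hU => ?_⟩
      by_cases hvU : v' ∈ U
      · rcases hF.chain.total hU hVF.1 with h | h
        · exact Or.inl h
        · exact Or.inr ⟨h, hvU⟩
      · rcases hF.chain.total hU hVF.1 with h | h
        · exact Or.inl h
        · exact Or.inl (hV.2 (Finset.mem_filter.2 ⟨hU, hvU⟩) h)
  set W := V ⊔ Submodule.span ℚ {v'} with hW
  have hεW : ε ≤ subspaceSize t W (f x) := by
    by_cases hWF : W ∈ F
    · exact (hF.mem_Icc W hWF (Finset.notMem_empty _)).1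
    · refine hερ.trans (hF.le_of_comparable W hWF fun U hU => ?_)
      rcases hVmax U hU with h | ⟨h, h'⟩
      · exact Or.inr (h.trans le_sup_left)
      · exact Or.inl (sup_le h (by simpa using h'))
  refine hεW.trans ((subspaceSize_sup_span_le t V (f x) hVv).trans ?_)
  exact mul_le_of_le_one_right (by positivity) hV1

/-- **Quantitative nondivergence** for the lattices `g_t u_{f(x)} ℤ^(n+1)` near a nondegenerate
point, with constants independent of `t`. -/
theorem IsNondegenerateOfOrder.exists_volume_short_le {l : ℕ} (hl : 1 ≤ l)
    {f : (Fin d → ℝ) → (Fin n → ℝ)} {x₀ : Fin d → ℝ} (h : IsNondegenerateOfOrder l f x₀)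
    (hf : ContDiffAt ℝ l f x₀) :
    ∃ (N₀ : ℕ) (C α : ℝ), 0 < C ∧ 0 < α ∧ ∀ (t : Fin n → ℕ) (ε : ℝ), 0 < ε →
      volume ({x | ∃ v : Fin (n + 1) → ℤ, v ≠ 0 ∧ ‖flowMap t (f x) fun i => (v i : ℝ)‖ < ε} ∩
        dyadicCube N₀ x₀) ≤ ENNReal.ofReal (C * ε ^ α) := by
  obtain ⟨N₀, C, α, ρ₀, hC, hα, hρ₀, hsmooth, hgood, hsup⟩ := h.exists_good hl hf
  set ρ : ℝ := min ρ₀ 1 with hρ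
  have hρ0 : 0 < ρ := by positivity
  set D : ℝ := ((n + 3 : ℕ) : ℝ) * (2 ^ d) ^ (n + 3) * C + 1 with hD
  have hD0 : 0 < D := by positivity
  set vol : ℝ := (volume (dyadicCube N₀ x₀)).toReal with hvol
  have hvol0 : 0 < vol := ENNReal.toReal_pos volume_dyadicCube_ne_zero volume_dyadicCube_ne_top
  have hvolQ : volume (dyadicCube N₀ x₀) = ENNReal.ofReal vol :=
    (ENNReal.ofReal_toReal volume_dyadicCube_ne_top).symm
  refine ⟨N₀, D * ((n + 1) / ρ) ^ α * vol, α, by positivity, hα, fun t ε₁ hε₁ => ?_⟩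
  -- a vector shorter than `ε₁` prevents protection at the level `ε`
  set ε : ℝ := (n + 1) * ε₁ with hε
  have hε0 : 0 < ε := by positivity
  have hgoal : volume ({x | ∃ v : Fin (n + 1) → ℤ, v ≠ 0 ∧
      ‖flowMap t (f x) fun i => (v i : ℝ)‖ < ε₁} ∩ dyadicCube N₀ x₀) ≤
      ENNReal.ofReal (D * (ε / ρ) ^ α) * volume (dyadicCube N₀ x₀) := by
    rcases lt_or_ge ρ ε with hlt | hle
    · refine (measure_mono Set.inter_subset_right).trans (le_mul_of_one_le_left zero_le ?_)
      rw [← ENNReal.ofReal_one]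
      refine ENNReal.ofReal_le_ofReal ?_
      have h1 : 1 ≤ (ε / ρ) ^ α := Real.one_le_rpow ((one_le_div hρ0).2 hlt.le) hα.le
      have h2 : 1 ≤ D := by
        rw [hD]
        exact le_add_of_nonneg_left (by positivity)
      nlinarith
    · let ψ : Submodule ℚ (Fin (n + 1) → ℚ) → (Fin d → ℝ) → ℝ := fun V x =>
        subspaceSize t V (f x)
      have hcont : ∀ V, ∀ x ∈ dyadicCube N₀ x₀, ContinuousAt (ψ V) x := by
        intro V x hx
        have hfx : ContinuousAt f x := (hsmooth x hx).continuousAt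
        have h1 : ContinuousAt (fun x => minors fun b => flowMap t (f x)
            fun i => (minBasis V b i : ℝ)) x := by
          refine continuousAt_pi.2 fun σ => ?_
          obtain ⟨c₀, c, hc⟩ := exists_minors_flowMap_eq t
            (fun b i => (minBasis V b i : ℝ)) σ
          simp only [hc]
          exact continuousAt_const.add ((linComb c).continuous.continuousAt.comp hfx)
        exact h1.norm
      have hgoodψ : ∀ V N x, N₀ ≤ N → x ∈ dyadicCube N₀ x₀ →
          (∃ y ∈ dyadicCube N x, ρ ≤ ψ V y) →
          volume ({y | ψ V y < ε} ∩ dyadicCube N x) ≤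
            ENNReal.ofReal (C * (ε / ρ) ^ α) * volume (dyadicCube N x) := by
        rintro V N x hN hx ⟨y, hy, hyρ⟩
        -- the minor that is largest at `y` controls the whole sublevel set
        obtain ⟨σ, hσ⟩ : ∃ σ, ρ ≤ |minors (fun b => flowMap t (f y)
            fun i => (minBasis V b i : ℝ)) σ| := by
          by_contra! hlt
          exact absurd hyρ (not_le.2 ((pi_norm_lt_iff hρ0).2 hlt))
        obtain ⟨c₀, c, hc⟩ := exists_minors_flowMap_eq t (fun b i => (minBasis V b i : ℝ)) σ
        rw [hc] at hσ
        refine (measure_mono ?_).trans (hgood c₀ c N x hN hx ρ hρ0 ⟨y, hy, hσ⟩ ε hε0)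
        refine Set.inter_subset_inter_left _ fun z hz => ?_
        refine lt_of_le_of_lt ?_ (show ψ V z < ε from hz)
        rw [← hc]
        exact norm_le_pi_norm (minors fun b => flowMap t (f z) fun i => (minBasis V b i : ℝ)) σ
      have hsupψ : ∀ V, ∃ y ∈ dyadicCube N₀ x₀, ρ ≤ ψ V y := by
        intro V
        obtain ⟨σ, c₀, c, hc, hle⟩ := exists_le_minors_flowMap t
          (isIntBasis_minBasis V).linearIndependent
        obtain ⟨y, hy, hyρ⟩ := hsup c₀ c hc
        refine ⟨y, hy, (min_le_left _ _).trans (hyρ.trans ((hle (f y)).trans ?_))⟩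
        exact norm_le_pi_norm (minors fun b => flowMap t (f y)
          fun i => (minBasis V b i : ℝ)) σ
      have hmain := volume_unprotected_le (P := Submodule ℚ (Fin (n + 1) → ℚ))
        (fun V => Module.finrank ℚ V)
        (fun V W hVW => Submodule.finrank_lt_finrank_of_lt hVW) (K := n + 2)
        (fun V => Nat.lt_succ_of_le ((Submodule.finrank_le V).trans_eq (by simp)))
        ψ hcont hgoodψ (n + 3) ∅ (by simp) (by simp) N₀ x₀ le_rfl mem_dyadicCube_self
        fun V _ _ => hsupψ V
      refine (measure_mono ?_).trans (hmain.trans ?_)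
      · refine Set.inter_subset_inter_left _ ?_
        rintro x ⟨v, hv, hvε⟩ ⟨F, hF⟩
        have h1 := le_norm_flowMap_of_isProtecting hle (min_le_right _ _) hF hv
        have h2 : (n + 1 : ℝ) * ‖flowMap t (f x) fun i => (v i : ℝ)‖ < (n + 1) * ε₁ := by
          gcongr
        exact absurd h1 (not_le.2 h2)
      · gcongr ?_ * _
        have h1 : (2 : ENNReal) = ENNReal.ofReal 2 := by simp
        rw [h1, ← ENNReal.ofReal_natCast, ← ENNReal.ofReal_pow (by positivity),
          ← ENNReal.ofReal_pow (by positivity), ← ENNReal.ofReal_mul (by positivity),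
          ← ENNReal.ofReal_mul (by positivity)]
        refine ENNReal.ofReal_le_ofReal ?_
        rw [← mul_assoc]
        gcongr
        rw [hD]
        exact le_add_of_nonneg_right zero_le_one
  refine hgoal.trans (le_of_eq ?_)
  rw [hvolQ, ← ENNReal.ofReal_mul (by positivity)]
  congr 1
  rw [hε, mul_div_right_comm, Real.mul_rpow (by positivity) hε₁.le]
  ring

end Flow

/-! ### The Borel-Cantelli argument -/

section BorelCantelli

variable {d n : ℕ}

lemma one_le_absPlus (x : ℝ) : 1 ≤ absPlus x := le_max_right _ _

lemma one_le_prodPlus (x : Fin n → ℝ) : 1 ≤ prodPlus x :=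
  Finset.one_le_prod fun i _ => one_le_absPlus (x i)

/-- Dani's correspondence: if `y` is very well multiplicatively approximable, the lattice
`g_t u_y ℤ^(n+1)` has an exponentially short vector for infinitely many `t ∈ ℕⁿ`. A good
approximation `q` is made short by the `t` with `2 ^ t i ≈ |q i|₊ Π₊(q) ^ δ`. -/
lemma IsVWMA.exists_infinite_short {y : Fin n → ℝ} (hy : IsVWMA y) :
    ∃ a : ℝ, 0 < a ∧ a < 1 ∧ {t : Fin n → ℕ | ∃ v : Fin (n + 1) → ℤ, v ≠ 0 ∧
      ‖flowMap t y fun i => (v i : ℝ)‖ < 4 * 2 ^ n * a ^ ∑ i, t i}.Infinite := by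
  obtain ⟨ε, hε, hinf⟩ := hy
  set δ : ℝ := ε / (n + 1) with hδ
  have hδ0 : 0 < δ := by positivity
  set γ : ℝ := δ / (1 + n * δ) with hγ
  have hγ0 : 0 < γ := by positivity
  have h2γ : (0 : ℝ) < 2 ^ (-γ) := by positivity
  refine ⟨2 ^ (-γ), h2γ, Real.rpow_lt_one_of_one_lt_of_neg one_lt_two (by linarith), ?_⟩
  let P : (Fin n → ℤ) → ℝ := fun q => prodPlus fun i => (q i : ℝ)
  have hP1 : ∀ q, 1 ≤ P q := fun q => one_le_prodPlus _
  let t : (Fin n → ℤ) → Fin n → ℕ := fun q i => ⌈Real.logb 2 (absPlus (q i) * P q ^ δ)⌉₊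
  have harg : ∀ q i, 1 ≤ absPlus (q i) * P q ^ δ := fun q i =>
    one_le_mul_of_one_le_of_one_le (one_le_absPlus _) (Real.one_le_rpow (hP1 q) hδ0.le)
  have hlow : ∀ q i, absPlus (q i) * P q ^ δ ≤ 2 ^ t q i := by
    intro q i
    rw [← Real.rpow_natCast, ← Real.logb_le_iff_le_rpow one_lt_two (by linarith [harg q i])]
    exact Nat.le_ceil _
  have hup : ∀ q i, (2 : ℝ) ^ t q i ≤ 2 * (absPlus (q i) * P q ^ δ) := by
    intro q i
    have hpos : 0 < absPlus (q i) * P q ^ δ := by linarith [harg q i]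
    have h1 := (Nat.ceil_lt_add_one (Real.logb_nonneg one_lt_two (harg q i))).le
    calc (2 : ℝ) ^ t q i = 2 ^ (t q i : ℝ) := (Real.rpow_natCast _ _).symm
      _ ≤ 2 ^ (Real.logb 2 (absPlus (q i) * P q ^ δ) + 1) :=
          Real.rpow_le_rpow_of_exponent_le one_le_two h1
      _ = _ := by
          rw [Real.rpow_add two_pos, Real.rpow_one, Real.rpow_logb two_pos (by norm_num) hpos,
            mul_comm]
  have habs : ∀ q i, |(q i : ℝ)| ≤ 2 ^ t q i := fun q i => by
    refine le_trans ?_ (hlow q i)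
    exact (le_max_left _ _).trans (le_mul_of_one_le_right (zero_le_one.trans (one_le_absPlus _))
      (Real.one_le_rpow (hP1 q) hδ0.le))
  have hsum : ∀ q, (2 : ℝ) ^ ∑ i, t q i ≤ 2 ^ n * P q ^ (1 + n * δ) := by
    intro q
    have hP0 : 0 < P q := by linarith [hP1 q]
    rw [← Finset.prod_pow_eq_pow_sum]
    refine (Finset.prod_le_prod (fun i _ => by positivity) fun i _ => hup q i).trans_eq ?_
    rw [Finset.prod_mul_distrib, Finset.prod_mul_distrib, Finset.prod_const, Finset.prod_const,
      Finset.card_univ, Fintype.card_fin, ← Real.rpow_natCast (P q ^ δ), ← Real.rpow_mul hP0.le,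
      mul_comm δ, Real.rpow_add hP0, Real.rpow_one]
    rfl
  -- every `t` comes from finitely many `q`
  have himage : (t '' ({q : Fin n → ℤ | ∃ p : ℤ, |(∑ i, (q i : ℝ) * y i) + (p : ℝ)| * P q
      ≤ P q ^ (-ε)} \ {0})).Infinite := by
    intro hfin
    refine (hinf.sdiff (Set.finite_singleton 0)) ((hfin.biUnion (t := fun s =>
      Set.Icc (fun i => -(2 : ℤ) ^ s i) fun i => 2 ^ s i) fun s _ => Set.finite_Icc _ _).subset ?_)
    intro q hq
    refine Set.mem_biUnion (Set.mem_image_of_mem t hq) ?_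
    have h1 : ∀ i, |q i| ≤ 2 ^ t q i := fun i => by exact_mod_cast habs q i
    exact ⟨fun i => (abs_le.1 (h1 i)).1, fun i => (abs_le.1 (h1 i)).2⟩
  refine himage.mono ?_
  rintro _ ⟨q, ⟨⟨p, hp⟩, hq0⟩, rfl⟩
  have hP0 : 0 < P q := by linarith [hP1 q]
  refine ⟨Fin.cons p q, fun h => hq0 (funext fun i => by simpa using congrFun h i.succ), ?_⟩
  have hγ1 : γ * n ≤ 1 := by
    rw [hγ, div_mul_eq_mul_div, div_le_one (by positivity)]
    linarith
  have hdecay : P q ^ (-δ) ≤ 2 * ((2 : ℝ) ^ (-γ)) ^ ∑ i, t q i := by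
    have h1 : ((2 : ℝ) ^ ∑ i, t q i) ^ γ ≤ 2 * P q ^ δ := by
      calc ((2 : ℝ) ^ ∑ i, t q i) ^ γ ≤ (2 ^ n * P q ^ (1 + n * δ)) ^ γ := by
            gcongr; exact hsum q
        _ = (2 ^ n) ^ γ * P q ^ δ := by
            rw [Real.mul_rpow (by positivity) (by positivity), ← Real.rpow_mul hP0.le]
            congr 2
            rw [hγ]; field_simp
        _ ≤ 2 * P q ^ δ := by
            gcongr
            rw [← Real.rpow_natCast, ← Real.rpow_mul zero_le_two, mul_comm]
            simpa using Real.rpow_le_rpow_of_exponent_le one_le_two hγ1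
    have h2 : ((2 : ℝ) ^ (-γ)) ^ ∑ i, t q i = (((2 : ℝ) ^ ∑ i, t q i) ^ γ)⁻¹ := by
      rw [← Real.rpow_natCast, ← Real.rpow_natCast, ← Real.rpow_mul zero_le_two,
        ← Real.rpow_mul zero_le_two, ← Real.rpow_neg zero_le_two]
      congr 1
      ring
    rw [h2, Real.rpow_neg hP0.le, ← div_eq_mul_inv, inv_eq_one_div,
      div_le_div_iff₀ (by positivity) (by positivity), one_mul]
    exact h1
  have hshort : ‖flowMap (t q) y fun i => ((Fin.cons p q : Fin (n + 1) → ℤ) i : ℝ)‖ ≤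
      2 ^ n * P q ^ (-δ) := by
    refine (pi_norm_le_iff_of_nonneg (by positivity)).2 fun k => ?_
    induction k using Fin.cases with
    | zero =>
      rw [flowMap_apply_zero]
      simp only [Fin.cons_zero, Fin.cons_succ]
      rw [norm_mul, Real.norm_eq_abs, Real.norm_eq_abs, abs_of_pos (by positivity)]
      have h1 : |(p : ℝ) + ∑ i, y i * (q i : ℝ)| ≤ P q ^ (-ε) / P q := by
        rw [le_div_iff₀ hP0, add_comm, Finset.sum_congr rfl fun i _ => mul_comm (y i) _]
        exact hp
      calc (2 : ℝ) ^ (∑ i, t q i) * |(p : ℝ) + ∑ i, y i * (q i : ℝ)|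
          ≤ 2 ^ n * P q ^ (1 + n * δ) * (P q ^ (-ε) / P q) := by
            gcongr
            exact hsum q
        _ = 2 ^ n * P q ^ (-δ) := by
            rw [mul_assoc]
            congr 1
            nth_rewrite 3 [← Real.rpow_one (P q)]
            rw [← Real.rpow_sub hP0, ← Real.rpow_add hP0]
            congr 1
            rw [hδ]; field_simp; ring
    | succ i =>
      rw [flowMap_apply_succ]
      simp only [Fin.cons_succ]
      rw [norm_mul, Real.norm_eq_abs, Real.norm_eq_abs, abs_of_pos (by positivity), inv_mul_le_iff₀
        (by positivity), Real.rpow_neg hP0.le]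
      have h1 : |(q i : ℝ)| ≤ 2 ^ t q i * (P q ^ δ)⁻¹ := by
        rw [← div_eq_mul_inv, le_div_iff₀ (by positivity)]
        refine le_trans ?_ (hlow q i)
        gcongr
        exact le_max_left _ _
      refine h1.trans ?_
      gcongr
      exact le_mul_of_one_le_left (by positivity) (one_le_pow₀ one_le_two)
  calc _ ≤ 2 ^ n * P q ^ (-δ) := hshort
    _ ≤ 2 ^ n * (2 * ((2 : ℝ) ^ (-γ)) ^ ∑ i, t q i) := by gcongr
    _ = 2 * 2 ^ n * ((2 : ℝ) ^ (-γ)) ^ ∑ i, t q i := by ring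
    _ < _ := by
        gcongr
        norm_num

lemma tsum_pow_sum_eq (b : ENNReal) (n : ℕ) :
    ∑' t : Fin n → ℕ, b ^ ∑ i, t i = (∑' k : ℕ, b ^ k) ^ n := by
  induction n with
  | zero => simp
  | succ n ih =>
    rw [← (Fin.consEquiv fun _ : Fin (n + 1) => ℕ).tsum_eq, ENNReal.tsum_prod', pow_succ', ← ih,
      ← ENNReal.tsum_mul_right]
    refine tsum_congr fun k => ?_
    rw [← ENNReal.tsum_mul_left]
    refine tsum_congr fun t => ?_
    simp [Fin.consEquiv, Fin.sum_univ_succ, pow_add]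

/-- Near a nondegenerate point almost no value of `f` is very well multiplicatively approximable,
by quantitative nondivergence and the Borel-Cantelli lemma. -/
theorem IsNondegenerateOfOrder.exists_ae_not_isVWMA {l : ℕ} (hl : 1 ≤ l)
    {f : (Fin d → ℝ) → (Fin n → ℝ)} {x₀ : Fin d → ℝ} (h : IsNondegenerateOfOrder l f x₀)
    (hf : ContDiffAt ℝ l f x₀) :
    ∃ N₀ : ℕ, ∀ᵐ x, x ∈ dyadicCube N₀ x₀ → ¬ IsVWMA (f x) := by
  obtain ⟨N₀, C, α, hC, hα, hvol⟩ := h.exists_volume_short_le hl hf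
  refine ⟨N₀, ?_⟩
  have hall : ∀ a : ℚ, ∀ᵐ x, (0 : ℝ) < a → (a : ℝ) < 1 → x ∈ dyadicCube N₀ x₀ →
      {t : Fin n → ℕ | ∃ v : Fin (n + 1) → ℤ, v ≠ 0 ∧
        ‖flowMap t (f x) fun i => (v i : ℝ)‖ < 4 * 2 ^ n * a ^ ∑ i, t i}.Finite := by
    intro a
    by_cases ha : (0 : ℝ) < a ∧ (a : ℝ) < 1
    swap
    · exact Filter.Eventually.of_forall fun x h0 h1 => absurd ⟨h0, h1⟩ ha
    obtain ⟨ha0, ha1⟩ := ha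
    let s : (Fin n → ℕ) → Set (Fin d → ℝ) := fun t =>
      {x | ∃ v : Fin (n + 1) → ℤ, v ≠ 0 ∧
        ‖flowMap t (f x) fun i => (v i : ℝ)‖ < 4 * 2 ^ n * a ^ ∑ i, t i} ∩ dyadicCube N₀ x₀
    have hs : ∑' t, volume (s t) ≠ ⊤ := by
      have hb : ENNReal.ofReal ((a : ℝ) ^ α) < 1 := by
        rw [ENNReal.ofReal_lt_one]
        exact Real.rpow_lt_one ha0.le ha1 hα
      refine ne_top_of_le_ne_top (b := ∑' t : Fin n → ℕ,
        ENNReal.ofReal (C * (4 * 2 ^ n) ^ α) * ENNReal.ofReal ((a : ℝ) ^ α) ^ ∑ i, t i) ?_ ?_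
      · rw [ENNReal.tsum_mul_left, tsum_pow_sum_eq, ENNReal.tsum_geometric]
        refine ENNReal.mul_ne_top ENNReal.ofReal_ne_top (ENNReal.pow_ne_top ?_)
        exact ENNReal.inv_ne_top.2 (tsub_pos_of_lt hb).ne'
      · refine ENNReal.tsum_le_tsum fun t => (hvol t _ (by positivity)).trans (le_of_eq ?_)
        have hpow : ((a : ℝ) ^ ∑ i, t i) ^ α = ((a : ℝ) ^ α) ^ ∑ i, t i := by
          rw [← Real.rpow_natCast, ← Real.rpow_natCast, ← Real.rpow_mul ha0.le,
            ← Real.rpow_mul ha0.le, mul_comm]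
        rw [← ENNReal.ofReal_pow (by positivity), ← ENNReal.ofReal_mul (by positivity),
          Real.mul_rpow (by positivity) (by positivity), hpow, mul_assoc]
    filter_upwards [ae_finite_setOfPred_mem hs] with x hx _ _ hxQ
    exact hx.subset fun t ht => ⟨ht, hxQ⟩
  filter_upwards [ae_all_iff.2 hall] with x hx hxQ hvwma
  obtain ⟨a, ha0, ha1, hinf⟩ := hvwma.exists_infinite_short
  obtain ⟨b, hab, hb1⟩ := exists_rat_btwn ha1
  refine hinf ((hx b (ha0.trans hab) hb1 hxQ).subset ?_)
  rintro t ⟨v, hv, hlt⟩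
  refine ⟨v, hv, hlt.trans_le ?_⟩
  gcongr

end BorelCantelli

/-! ### Extremality -/

section Final

variable {d n : ℕ}

lemma not_isVWMA_of_isEmpty {y : Fin 0 → ℝ} : ¬ IsVWMA y := fun ⟨_, _, h⟩ => h (Set.toFinite _)

/-- A map that is nondegenerate at almost every point of an open set has strongly extremal image. -/
theorem isStronglyExtremal_of_ae_isNondegenerate {m : ℕ∞} {U : Set (Fin d → ℝ)}
    {f : (Fin d → ℝ) → (Fin n → ℝ)} (hU : IsOpen U) (hf : ContDiffOn ℝ m f U)
    (hnd : ∀ᵐ x ∂(volume.restrict U), IsNondegenerate m f x) : IsStronglyExtremal U f := by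
  rcases Nat.eq_zero_or_pos n with rfl | hn
  · exact Filter.Eventually.of_forall fun x => not_isVWMA_of_isEmpty
  have hloc : ∀ x ∈ U, IsNondegenerate m f x →
      ∃ N, ∀ᵐ z, z ∈ dyadicCube N x → ¬ IsVWMA (f z) := by
    rintro x hx ⟨l, hlm, hl⟩
    have hl1 : 1 ≤ l := by
      -- there are no derivatives of order `1, …, 0`, and `ℝⁿ` is not trivial
      by_contra! hl0
      have hempty : {v : Fin n → ℝ | ∃ k : ℕ, 1 ≤ k ∧ k ≤ l ∧ ∃ i : Fin k → Fin d,
          v = partialDeriv f i x} = ∅ := by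
        rw [Set.eq_empty_iff_forall_notMem]
        rintro v ⟨k, hk1, hk2, -⟩
        omega
      rw [IsNondegenerateOfOrder, hempty, Submodule.span_empty] at hl
      have : Nonempty (Fin n) := ⟨⟨0, hn⟩⟩
      exact bot_ne_top hl
    exact hl.exists_ae_not_isVWMA hl1 (((hf x hx).contDiffAt (hU.mem_nhds hx)).of_le
      (by exact_mod_cast hlm))
  let 𝒬 : Set (Set (Fin d → ℝ)) :=
    {Q | Q ∈ Set.range (fun p : ℕ × (Fin d → ℝ) => dyadicCube p.1 p.2) ∧
      ∀ᵐ z, z ∈ Q → ¬ IsVWMA (f z)}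
  have hcount : 𝒬.Countable := countable_range_dyadicCube.mono fun Q hQ => hQ.1
  have hae : ∀ᵐ z, ∀ Q ∈ 𝒬, z ∈ Q → ¬ IsVWMA (f z) :=
    (ae_ball_iff hcount).2 fun Q hQ => hQ.2
  unfold IsStronglyExtremal
  filter_upwards [ae_restrict_of_ae hae, hnd, ae_restrict_mem hU.measurableSet] with x hx hxnd hxU
  obtain ⟨N, hN⟩ := hloc x hxU hxnd
  exact hx _ ⟨⟨(N, x), rfl⟩, hN⟩ mem_dyadicCube_self

lemma IsVWA.isVWMA {y : Fin n → ℝ} (hy : IsVWA y) : IsVWMA y := by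
  obtain ⟨ε, hε, hinf⟩ := hy
  refine ⟨ε, hε, (hinf.sdiff (Set.finite_singleton 0)).mono ?_⟩
  rintro q ⟨⟨p, hp⟩, hq0⟩
  refine ⟨p, ?_⟩
  have hq1 : 1 ≤ ‖q‖ := by
    obtain ⟨i, hi⟩ := Function.ne_iff.1 hq0
    refine le_trans ?_ (norm_le_pi_norm q i)
    rw [Int.norm_eq_abs]
    exact_mod_cast Int.one_le_abs hi
  have hle : prodPlus (fun i => (q i : ℝ)) ≤ ‖q‖ ^ n := by
    have h1 : ∀ i ∈ (Finset.univ : Finset (Fin n)), absPlus (q i : ℝ) ≤ ‖q‖ := fun i _ =>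
      max_le ((Int.norm_eq_abs (q i)).symm.trans_le (norm_le_pi_norm q i)) hq1
    refine (Finset.prod_le_prod (fun i _ => zero_le_one.trans (one_le_absPlus _)) h1).trans_eq ?_
    simp
  have hpos : 0 < prodPlus (fun i => (q i : ℝ)) := zero_lt_one.trans_le (one_le_prodPlus _)
  calc |(∑ i, (q i : ℝ) * y i) + (p : ℝ)| * prodPlus (fun i => (q i : ℝ))
      ≤ |(∑ i, (q i : ℝ) * y i) + (p : ℝ)| * ‖q‖ ^ n := by gcongr
    _ ≤ ‖q‖ ^ (-((n : ℝ) * ε)) := hp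
    _ = (‖q‖ ^ n) ^ (-ε) := by
        rw [← Real.rpow_natCast, ← Real.rpow_mul (norm_nonneg _)]
        congr 1
        ring
    _ ≤ _ := Real.rpow_le_rpow_of_nonpos hpos hle (by linarith)

lemma IsStronglyExtremal.isExtremal {U : Set (Fin d → ℝ)} {f : (Fin d → ℝ) → (Fin n → ℝ)}
    (h : IsStronglyExtremal U f) : IsExtremal U f :=
  h.mono fun _ hx hx' => hx hx'.isVWMA

/-- If all partial derivatives at `x` of positive order of an analytic map lie in the kernel of
the linear functional `L`, then `L ∘ f` is constant near `x`. -/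
lemma eventually_eq_of_partialDeriv_mem_ker {f : (Fin d → ℝ) → (Fin n → ℝ)} {x : Fin d → ℝ}
    (hf : AnalyticAt ℝ f x) (L : (Fin n → ℝ) →L[ℝ] ℝ)
    (hL : ∀ k, 1 ≤ k → ∀ i : Fin k → Fin d, L (partialDeriv f i x) = 0) :
    ∀ᶠ z in nhds x, L (f z) = L (f x) := by
  obtain ⟨p, r, hp⟩ := hf
  have hball : ∀ᶠ z in nhds x, z ∈ Metric.eball x r := Metric.eball_mem_nhds x hp.r_pos
  filter_upwards [hball] with z hz
  have hzx : z - x ∈ Metric.eball (0 : Fin d → ℝ) r := by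
    simpa [Metric.mem_eball, edist_eq_enorm_sub] using hz
  have hsum := (hp.hasSum_iteratedFDeriv hzx).mapL L
  rw [add_sub_cancel] at hsum
  have hzero : ∀ k, k ≠ 0 →
      L ((k.factorial : ℝ)⁻¹ • iteratedFDeriv ℝ k f x fun _ => z - x) = 0 := by
    intro k hk
    rw [map_smul]
    have hexp : (fun _ : Fin k => z - x) =
        fun _ => ∑ i, (z - x) i • (Pi.single i 1 : Fin d → ℝ) := by
      ext _ j
      simp [Finset.sum_apply, Pi.single_apply]
    rw [hexp, ContinuousMultilinearMap.map_sum, map_sum, Finset.sum_eq_zero, smul_zero]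
    intro i _
    rw [ContinuousMultilinearMap.map_smul_univ, map_smul]
    have := hL k (Nat.one_le_iff_ne_zero.2 hk) i
    rw [partialDeriv] at this
    rw [this, smul_zero]
  have h0 := hasSum_single (f := fun k : ℕ =>
    L ((k.factorial : ℝ)⁻¹ • iteratedFDeriv ℝ k f x fun _ => z - x)) 0 hzero
  have := hsum.unique h0
  simpa using this

/-- Analytic functions that together with `1` are linearly independent on a connected open set
define a map which is nondegenerate at every point: otherwise a linear combination of them has
vanishing derivatives at some point and is constant by the identity theorem. -/
theorem isNondegenerate_of_linIndepWithOne {U : Set (Fin d → ℝ)}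
    {f : (Fin d → ℝ) → (Fin n → ℝ)} (hU : IsPreconnected U) (hf : AnalyticOnNhd ℝ f U)
    (hlin : LinIndepWithOne U f) {x : Fin d → ℝ} (hx : x ∈ U) : IsNondegenerate ⊤ f x := by
  by_contra hdeg
  simp only [IsNondegenerate, le_top, true_and, not_exists] at hdeg
  let W : ℕ →o Submodule ℝ (Fin n → ℝ) :=
    { toFun := fun l => Submodule.span ℝ {v : Fin n → ℝ | ∃ k : ℕ, 1 ≤ k ∧ k ≤ l ∧
        ∃ i : Fin k → Fin d, v = partialDeriv f i x}
      monotone' := fun l l' hll' => Submodule.span_mono fun v ⟨k, h1, h2, h3⟩ =>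
        ⟨k, h1, h2.trans hll', h3⟩ }
  obtain ⟨l, hl⟩ := monotone_stabilizes_iff_noetherian.2
    (inferInstance : IsNoetherian ℝ (Fin n → ℝ)) W
  obtain ⟨L, hL0, hLW⟩ := Submodule.exists_le_ker_of_lt_top (W l)
    (lt_top_iff_ne_top.2 (hdeg l))
  let L' : (Fin n → ℝ) →L[ℝ] ℝ := LinearMap.toContinuousLinearMap L
  have hL' : ∀ k, 1 ≤ k → ∀ i : Fin k → Fin d, L' (partialDeriv f i x) = 0 := by
    intro k hk i
    refine hLW ?_
    rw [hl (max k l) (le_max_right _ _)]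
    exact Submodule.subset_span ⟨k, hk, le_max_left _ _, i, rfl⟩
  have hconst : Set.EqOn (fun z => L' (f z)) (fun _ => L' (f x)) U :=
    (L'.comp_analyticOnNhd hf).eqOn_of_preconnected_of_eventuallyEq analyticOnNhd_const hU hx
      (eventually_eq_of_partialDeriv_mem_ker (hf x hx) L' hL')
  refine hL0 (LinearMap.pi_ext' fun i => LinearMap.ext_ring ?_)
  have hcoef := Fintype.linearIndependent_iff.1 hlin
    (Fin.cons (-L' (f x)) fun i => L (Pi.single i 1)) (by
      ext z
      rw [Fin.sum_univ_succ]
      have h1 := hconst z.2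
      have h2 : L' (f z) = ∑ i, L (Pi.single i 1) * f z i := by
        change L (f z) = _
        rw [LinearMap.pi_apply_eq_sum_univ L (f z)]
        refine Finset.sum_congr rfl fun i _ => ?_
        rw [smul_eq_mul, mul_comm]
        congr 2
        ext j
        simp [Pi.single_apply, eq_comm]
      simp only [h2] at h1
      simp [Finset.sum_apply, h1]) i.succ
  simpa using hcoef

theorem isStronglyExtremal_of_analytic {U : Set (Fin d → ℝ)} {f : (Fin d → ℝ) → (Fin n → ℝ)}
    (hUo : IsOpen U) (hU : IsConnected U) (hf : AnalyticOnNhd ℝ f U)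
    (hlin : LinIndepWithOne U f) : IsStronglyExtremal U f := by
  refine isStronglyExtremal_of_ae_isNondegenerate (m := ⊤) hUo
    hf.contDiffOn_of_completeSpace ?_
  filter_upwards [ae_restrict_mem hUo.measurableSet] with x hx
  exact isNondegenerate_of_linIndepWithOne hU.isPreconnected hf hlin hx

/-- The powers `1, x, …, xⁿ` are linearly independent. -/
lemma linIndepWithOne_pow (n : ℕ) : LinIndepWithOne (Set.univ : Set (Fin 1 → ℝ))
    (fun x (i : Fin n) => x 0 ^ ((i : ℕ) + 1)) := by
  refine Fintype.linearIndependent_iff.2 fun g hg => ?_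
  let p : Polynomial ℝ := ∑ k : Fin (n + 1), Polynomial.C (g k) * Polynomial.X ^ (k : ℕ)
  have hp : p = 0 := by
    refine Polynomial.funext fun x => ?_
    have h1 := congrFun hg ⟨fun _ => x, trivial⟩
    rw [Polynomial.eval_zero, Polynomial.eval_finsetSum]
    rw [Finset.sum_apply] at h1
    refine (Finset.sum_congr rfl fun k _ => ?_).trans h1
    induction k using Fin.cases <;> simp
  intro k
  have h2 := congrArg (fun p => Polynomial.coeff p k) hp
  simpa [p, Polynomial.finsetSum_coeff, Polynomial.coeff_C_mul, Polynomial.coeff_X_pow,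
    Fin.val_inj] using h2

theorem ae_not_isVWA_pow (n : ℕ) :
    ∀ᵐ x : ℝ, ¬ IsVWA (fun i : Fin n => x ^ ((i : ℕ) + 1)) := by
  have hf : AnalyticOnNhd ℝ (fun (x : Fin 1 → ℝ) (i : Fin n) => x 0 ^ ((i : ℕ) + 1)) Set.univ :=
    analyticOnNhd_pi_iff.2 fun i =>
      ((ContinuousLinearMap.proj (R := ℝ) (φ := fun _ : Fin 1 => ℝ) 0).analyticOnNhd _).pow _
  have h := (isStronglyExtremal_of_analytic isOpen_univ isConnected_univ hf
    (linIndepWithOne_pow n)).isExtremal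
  rw [IsExtremal, Measure.restrict_univ] at h
  exact ((volume_preserving_funUnique (Fin 1) ℝ).symm _).quasiMeasurePreserving.ae h

end Final

end DiophApprox

theorem theoremA :
    -- almost everywhere nondegenerate maps have strongly extremal image
    (∀ (d n : ℕ) (m : ℕ∞) (U : Set (Fin d → ℝ)) (f : (Fin d → ℝ) → (Fin n → ℝ)),
      IsOpen U → ContDiffOn ℝ m f U →
      (∀ᵐ x ∂(volume.restrict U), DiophApprox.IsNondegenerate m f x) →
      DiophApprox.IsStronglyExtremal U f) ∧
    -- Conjecture H2
    (∀ (d n : ℕ) (U : Set (Fin d → ℝ)) (f : (Fin d → ℝ) → (Fin n → ℝ)),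
      IsOpen U → IsConnected U → AnalyticOnNhd ℝ f U → DiophApprox.LinIndepWithOne U f →
      DiophApprox.IsStronglyExtremal U f) ∧
    -- Conjecture H1
    (∀ (d n : ℕ) (U : Set (Fin d → ℝ)) (f : (Fin d → ℝ) → (Fin n → ℝ)),
      IsOpen U → IsConnected U → AnalyticOnNhd ℝ f U → DiophApprox.LinIndepWithOne U f →
      DiophApprox.IsExtremal U f) ∧
    -- Mahler's conjecture
    (∀ n : ℕ, ∀ᵐ x : ℝ, ¬ DiophApprox.IsVWA (fun i : Fin n => x ^ ((i : ℕ) + 1))) :=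
  ⟨fun _ _ _ _ _ hU hf h => DiophApprox.isStronglyExtremal_of_ae_isNondegenerate hU hf h,
    fun _ _ _ _ hUo hU hf h => DiophApprox.isStronglyExtremal_of_analytic hUo hU hf h,
    fun _ _ _ _ hUo hU hf h => (DiophApprox.isStronglyExtremal_of_analytic hUo hU hf h).isExtremal,
    DiophApprox.ae_not_isVWA_pow⟩
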